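/- **Setting.** Normalize $\mathcal F f(\xi)=\hat f(\xi)=\int_{\mathbb R^d} f(x)e^{-2\pi i x\cdot\xi}\,dx$. Let $\emptyset\neq\mathcal O\subset\mathbb R^d$ be open and let $\mathcal Q=(Q_i)_{i\in I}$ be an *admissible cover* of $\mathcal O$: $\bigcup_i Q_i=\mathcal O$, all $Q_i\ne\emptyset$, and $\sup_{i}|i^*|<\infty$ where $i^*=\{\ell\in I: Q_\ell\cap Q_i\neq\emptyset\}$. Let $\Phi=(\varphi_i)_{i\in I}$ be a *bounded admissible partition of unity* (BAPU) subordinate to $\mathcal Q$: $\varphi_i\in C_c^\infty(\mathcal O)$, $\sum_i\varphi_i=1$ on $\mathcal O$, $\varphi_i=0$ on $\mathcal O\setminus Q_i$, and $C_\Phi:=\sup_i\|\mathcal F^{-1}\varphi_i\|_{L^1}<\infty$. Let $w=(w_i)_{i\in I}$ be a *$\mathcal Q$-moderate weight*: $w_i\in(0,\infty)$ and $\sup_i\sup_{\ell\in i^*}w_i/w_\ell<\infty$. Put $\|c\|_{\ell^q_w}=\|(w_ic_i)_i\|_{\ell^q}$, and let $\Gamma_{\mathcal Q}:\ell^q_w(I)\to\ell^q_w(I)$,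 $(\Gamma_{\mathcal Q}c)_i=\sum_{\ell\in i^*}c_\ell$. Let $Z(\mathcal O)=\mathcal F(C_c^\infty(\mathcal O))$ carry the topology transported from $C_c^\infty(\mathcal O)$ by $\mathcal F$, and let $Z'(\mathcal O)$ be its topological dual with the weak-* topology. For $f\in Z'(\mathcal O)$ put $\hat f=f\circ\mathcal F\in\mathcal D'(\mathcal O)$. For each $i$, $\varphi_i\hat f$ is a compactly supported (tempered) distribution and $\mathcal F^{-1}(\varphi_i\hat f)$ is a smooth function. Set $$\|f\|_{\mathcal D(\mathcal Q,L^p,\ell^q_w)}=\Big\|\big(\|\mathcal F^{-1}(\varphi_i\hat f)\|_{L^p}\big)_{i\in I}\Big\|_{\ell^q_w}\in[0,\infty],\qquad \mathcal D(\mathcal Q,L^p,\ell^q_w)=\{f\in Z'(\mathcal O):\|f\|_{\mathcal D(\mathcal Q,L^p,\ell^q_w)}<\infty\}.$$ Let $\mathcal S_{\mathcal O}(\mathbb R^d)=\mathcal F^{-1}(C_c^\infty(\mathcal O))$; a function $g\in\mathcal S_{\mathcal O}(\mathbb R^d)$ is identified with the element $\psi\mapsto\int g\,\psi\,dx$ of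 $Z'(\mathcal O)$. For a family $F=(F_i)_{i\in I}$ of functions on $\mathbb R^d$ put $\|F\|_{\ell^q_w(I;L^p)}=\|(\|F_i\|_{L^p})_i\|_{\ell^q_w}$, and let $\ell^q_w(I;L^p)$ be the set of families with $F_i\in L^p(\mathbb R^d)$ for all $i$ and $\|F\|_{\ell^q_w(I;L^p)}<\infty$. For $F_i:\mathbb R^d\to[0,\infty)$, an $f\in Z'(\mathcal O)$ is *$(F,\Phi)$-dominated* if $|\mathcal F^{-1}(\varphi_i\hat f)|\le F_i$ for all $i\in I$. **Proposition.** 1. $\mathcal S_{\mathcal O}(\mathbb R^d)\subset\mathcal D(\mathcal Q,L^p,\ell^q_w)$ for all $p,q\in[1,\infty]$. 2. If $p,q\in[1,\infty)$, then $\mathcal S_{\mathcal O}(\mathbb R^d)$ is norm dense in $\mathcal D(\mathcal Q,L^p,\ell^q_w)$. 3. If $p,q\in[1,\infty]$ and $f\in\mathcal D(\mathcal Q,L^p,\ell^q_w)$, then there exist a family $F=(F_i)_{i\in I}\in\ell^q_w(I;L^p)$ of functions $F_i:\mathbb R^d\to[0,\infty)$ with $$\|F\|_{\ell^q_w(I;L^p)}\le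 C_\Phi\,\|\Gamma_{\mathcal Q}\|_{\ell^q_w\to\ell^q_w}^2\,\|f\|_{\mathcal D(\mathcal Q,L^p,\ell^q_w)}$$ and a sequence $(g_n)_{n\in\mathbb N}$ in $\mathcal S_{\mathcal O}(\mathbb R^d)$ of $(F,\Phi)$-dominated functions such that $g_n\to f$ in $Z'(\mathcal O)$. -/

import Mathlib

open MeasureTheory Set Filter Topology TopologicalSpace
open scoped ENNReal FourierTransform SchwartzMap Distributions

namespace DecompositionSpace

/-- `ℝ^d` with the Euclidean norm; it serves both as the space side and as the Fourier side. -/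
abbrev Rd (d : ℕ) : Type := EuclideanSpace ℝ (Fin d)

section FourierDistributions

variable {d : ℕ} {O : Opens (Rd d)}

/-- A test function on `O`, extended by zero, as a Schwartz function on `ℝ^d`. -/
noncomputable def toSchwartz (h : 𝓓(O, ℂ)) : 𝓢(Rd d, ℂ) :=
  h.hasCompactSupport.toSchwartzMap h.contDiff

theorem toSchwartz_apply (h : 𝓓(O, ℂ)) (ξ : Rd d) : toSchwartz h ξ = h ξ := rfl

/-- The Fourier transform `f̂(ξ) = ∫ f(x) exp(-2πi⟨x, ξ⟩) dx` as a linear map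
`C_c^∞(O) → 𝓢(ℝ^d)`. -/
noncomputable def fourierTest (O : Opens (Rd d)) : 𝓓(O, ℂ) →ₗ[ℂ] 𝓢(Rd d, ℂ) where
  toFun h := 𝓕 (toSchwartz h)
  map_add' f g := by
    rw [← FourierTransform.fourier_add]
    rfl
  map_smul' c f := by
    rw [RingHom.id_apply, ← FourierTransform.fourier_smul]
    rfl

/-- The Fourier test function space `Z(O) = F(C_c^∞(O))`, a linear subspace of `𝓢(ℝ^d)`.
It is a separate type because its topology is not the one inherited from `𝓢(ℝ^d)`. -/
def ZSpace (O : Opens (Rd d)) : Type := LinearMap.range (fourierTest O)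

noncomputable instance (O : Opens (Rd d)) : AddCommGroup (ZSpace O) :=
  inferInstanceAs (AddCommGroup (LinearMap.range (fourierTest O)))

noncomputable instance (O : Opens (Rd d)) : Module ℂ (ZSpace O) :=
  inferInstanceAs (Module ℂ (LinearMap.range (fourierTest O)))

/-- The inclusion `Z(O) ⊆ 𝓢(ℝ^d)`. -/
noncomputable def ZSpace.incl (O : Opens (Rd d)) : ZSpace O →ₗ[ℂ] 𝓢(Rd d, ℂ) :=
  (LinearMap.range (fourierTest O)).subtype

/-- The Fourier transform as a (surjective) linear map `C_c^∞(O) → Z(O)`. -/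
noncomputable def ZSpace.fourier (O : Opens (Rd d)) : 𝓓(O, ℂ) →ₗ[ℂ] ZSpace O :=
  (fourierTest O).rangeRestrict

theorem ZSpace.incl_fourier (h : 𝓓(O, ℂ)) :
    ZSpace.incl O (ZSpace.fourier O h) = 𝓕 (toSchwartz h) := rfl

theorem ZSpace.fourier_bijective (O : Opens (Rd d)) :
    Function.Bijective (ZSpace.fourier O) := by
  refine ⟨fun f g hfg => ?_, (fourierTest O).surjective_rangeRestrict⟩
  have h1 : 𝓕 (toSchwartz f) = 𝓕 (toSchwartz g) := congrArg (ZSpace.incl O) hfg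
  have h2 : toSchwartz f = toSchwartz g := by
    rw [← FourierTransform.fourierInv_fourier_eq (F := 𝓢(Rd d, ℂ)) (toSchwartz f), h1,
      FourierTransform.fourierInv_fourier_eq]
  ext ξ
  exact congrArg (fun u : 𝓢(Rd d, ℂ) => u ξ) h2

/-- The topology of `Z(O)` is the one transported from `C_c^∞(O)` (with its usual LF topology)
along the Fourier transform; see `ZSpace.isHomeomorph_fourier`. -/
noncomputable instance (O : Opens (Rd d)) : TopologicalSpace (ZSpace O) :=
  TopologicalSpace.coinduced (ZSpace.fourier O) inferInstance

theorem ZSpace.isHomeomorph_fourier (O : Opens (Rd d)) :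
    IsHomeomorph (ZSpace.fourier O) :=
  isHomeomorph_iff_isQuotientMap_injective.2
    ⟨⟨⟨rfl⟩, (ZSpace.fourier_bijective O).2⟩, (ZSpace.fourier_bijective O).1⟩

/-- The space `Z'(O)` of Fourier distributions: the topological dual of `Z(O)`. -/
abbrev ZDual (O : Opens (Rd d)) : Type := ZSpace O →L[ℂ] ℂ

/-- Convergence of a sequence in `Z'(O)`, i.e. in the weak-* topology. -/
def TendstoZDual (u : ℕ → ZDual O) (f : ZDual O) : Prop :=
  ∀ ψ : ZSpace O, Tendsto (fun n => u n ψ) atTop (𝓝 (f ψ))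

/-- The Fourier transform `f̂ = f ∘ F ∈ 𝓓'(O)` of a Fourier distribution `f ∈ Z'(O)`. -/
noncomputable def ZDual.hat (f : ZDual O) : 𝓓(O, ℂ) →L[ℂ] ℂ :=
  f.comp ⟨ZSpace.fourier O, (ZSpace.isHomeomorph_fourier O).continuous⟩

theorem ZDual.hat_apply (f : ZDual O) (h : 𝓓(O, ℂ)) :
    f.hat h = f (ZSpace.fourier O h) := rfl

/-- The Fourier distribution `ψ ↦ ∫ g(x) ψ(x) dx` given by a Schwartz function `g`. -/
noncomputable def toZDual (O : Opens (Rd d)) (g : 𝓢(Rd d, ℂ)) : ZDual O where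
  toFun ψ := ∫ x, g x * ZSpace.incl O ψ x
  map_add' ψ₁ ψ₂ := by
    rw [← integral_add]
    · simp only [map_add, add_apply, mul_add]
    · exact (SchwartzMap.integrable _).bdd_mul (c := SchwartzMap.seminorm ℂ 0 0 g)
        g.continuous.aestronglyMeasurable
        (Eventually.of_forall fun x => SchwartzMap.norm_le_seminorm ℂ g x)
    · exact (SchwartzMap.integrable _).bdd_mul (c := SchwartzMap.seminorm ℂ 0 0 g)
        g.continuous.aestronglyMeasurable
        (Eventually.of_forall fun x => SchwartzMap.norm_le_seminorm ℂ g x)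
  map_smul' c ψ := by
    rw [RingHom.id_apply, smul_eq_mul, ← integral_const_mul]
    refine integral_congr_ae (Eventually.of_forall fun x => ?_)
    simp only [map_smul, smul_apply, smul_eq_mul]
    ring
  cont := by
    refine continuous_coinduced_dom.2 ?_
    have hloc : LocallyIntegrableOn (fun ξ => (𝓕 g : 𝓢(Rd d, ℂ)) ξ) (O : Set (Rd d)) volume :=
      ((𝓕 g : 𝓢(Rd d, ℂ)).integrable.locallyIntegrable).locallyIntegrableOn _
    refine (TestFunction.integralAgainstBilinCLM (Ω := O) (n := ⊤)
      (ContinuousLinearMap.mul ℂ ℂ) volume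
      (fun ξ => (𝓕 g : 𝓢(Rd d, ℂ)) ξ)).continuous.congr fun h => ?_
    rw [TestFunction.integralAgainstBilinCLM_eq_integral hloc]
    change (∫ ξ, h ξ * (𝓕 g : 𝓢(Rd d, ℂ)) ξ) = ∫ x, g x * (𝓕 (toSchwartz h) : 𝓢(Rd d, ℂ)) x
    rw [← SchwartzMap.integral_fourier_mul_eq]
    exact integral_congr_ae (Eventually.of_forall fun ξ => mul_comm (h ξ) _)

/-- The space `S_O(ℝ^d) = F⁻¹(C_c^∞(O)) ⊆ 𝓢(ℝ^d)`. -/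
def SO (O : Opens (Rd d)) : Set 𝓢(Rd d, ℂ) :=
  range fun h : 𝓓(O, ℂ) => (𝓕⁻ (toSchwartz h) : 𝓢(Rd d, ℂ))

/-- The product `φ g ∈ C_c^∞(O)` of `φ ∈ C_c^∞(O)` with a Schwartz function `g`. -/
noncomputable def mulTest (φ : 𝓓(O, ℂ)) (g : 𝓢(Rd d, ℂ)) : 𝓓(O, ℂ) where
  toFun ξ := φ ξ * g ξ
  contDiff' := φ.contDiff.mul (g.smooth ⊤)
  hasCompactSupport' := φ.hasCompactSupport.mul_right
  tsupport_subset' := (tsupport_mul_subset_left).trans φ.tsupport_subset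

theorem mulTest_continuous (φ : 𝓓(O, ℂ)) : Continuous (mulTest φ) := by
  let K : Compacts (Rd d) := ⟨tsupport φ, φ.hasCompactSupport⟩
  have hK : (K : Set (Rd d)) ⊆ O := φ.tsupport_subset
  have hsupp : ∀ g : 𝓢(Rd d, ℂ), Function.support (fun ξ => φ ξ * g ξ) ⊆ K := fun g ξ hξ =>
    subset_tsupport φ (left_ne_zero_of_mul hξ)
  let T : 𝓢(Rd d, ℂ) →ₗ[ℂ] 𝓓_{K}(Rd d, ℂ) :=
    { toFun g := ContDiffMapSupportedIn.of_support_subset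
        (φ.contDiff.mul (g.smooth ⊤)) (hsupp g)
      map_add' := fun f g => by
        ext ξ
        exact mul_add _ _ _
      map_smul' := fun c g => by
        ext ξ
        exact mul_left_comm _ _ _ }
  have hT : Continuous T := by
    refine WithSeminorms.continuous_of_continuous_comp
      (ContDiffMapSupportedIn.withSeminorms ℂ (Rd d) ℂ ⊤ K) T fun i => ?_
    have hφ : (φ : Rd d → ℂ).HasTemperateGrowth := (toSchwartz φ).hasTemperateGrowth
    have hc : Continuous ((SchwartzMap.seminorm ℂ 0 i).comp
        (SchwartzMap.smulLeftCLM ℂ (φ : Rd d → ℂ)).toLinearMap) :=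
      ((schwartz_withSeminorms ℂ (Rd d) ℂ).continuous_seminorm (0, i)).comp
        (SchwartzMap.smulLeftCLM ℂ (φ : Rd d → ℂ)).continuous
    refine Seminorm.continuous_of_le hc fun g => ?_
    change ContDiffMapSupportedIn.seminorm ℂ (Rd d) ℂ ⊤ K i (T g) ≤
      SchwartzMap.seminorm ℂ 0 i (SchwartzMap.smulLeftCLM ℂ (φ : Rd d → ℂ) g)
    refine (ContDiffMapSupportedIn.seminorm_top_le_iff ℂ (apply_nonneg _ _) i _).2 fun ξ _ => ?_
    have he : (T g : Rd d → ℂ) = SchwartzMap.smulLeftCLM ℂ (φ : Rd d → ℂ) g := by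
      funext ξ
      rw [SchwartzMap.smulLeftCLM_apply_apply hφ]
      rfl
    rw [he]
    exact SchwartzMap.norm_iteratedFDeriv_le_seminorm ℂ _ i ξ
  exact (TestFunction.continuous_ofSupportedIn hK).comp hT

/-- Multiplication by `φ ∈ C_c^∞(O)` as a continuous linear map `𝓢(ℝ^d) → C_c^∞(O)`. -/
noncomputable def mulTestCLM (φ : 𝓓(O, ℂ)) : 𝓢(Rd d, ℂ) →L[ℂ] 𝓓(O, ℂ) where
  toFun := mulTest φ
  map_add' f g := by
    ext ξ
    exact mul_add (φ ξ) (f ξ) (g ξ)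
  map_smul' c g := by
    ext ξ
    exact mul_left_comm (φ ξ) c (g ξ)
  cont := mulTest_continuous φ

/-- For a distribution `T ∈ 𝓓'(O)` and `φ ∈ C_c^∞(O)`, the product `φ T`, a tempered distribution
on `ℝ^d` with compact support: `⟨φ T, g⟩ = ⟨T, φ g⟩` for Schwartz functions `g`. -/
noncomputable def localize (φ : 𝓓(O, ℂ)) (T : 𝓓(O, ℂ) →L[ℂ] ℂ) : 𝓢'(Rd d, ℂ) :=
  ContinuousLinearMap.toPointwiseConvergenceCLM _ _ _ _ (T.comp (mulTestCLM φ))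

theorem localize_apply (φ : 𝓓(O, ℂ)) (T : 𝓓(O, ℂ) →L[ℂ] ℂ) (g : 𝓢(Rd d, ℂ)) :
    localize φ T g = T (mulTest φ g) := rfl

/-- The piece `F⁻¹(φ f̂) ∈ 𝓢'(ℝ^d)` of a Fourier distribution `f ∈ Z'(O)`, for
`φ ∈ C_c^∞(O)`. -/
noncomputable def piece (φ : 𝓓(O, ℂ)) (f : ZDual O) : 𝓢'(Rd d, ℂ) :=
  𝓕⁻ (localize φ f.hat)

theorem piece_apply (φ : 𝓓(O, ℂ)) (f : ZDual O) (g : 𝓢(Rd d, ℂ)) :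
    piece φ f g = f (ZSpace.fourier O (mulTest φ (𝓕⁻ g))) := rfl

/-- The tempered distribution `T` is given by the function `u`. -/
def IsGivenBy (T : 𝓢'(Rd d, ℂ)) (u : Rd d → ℂ) : Prop :=
  ∀ g : 𝓢(Rd d, ℂ), Integrable (fun x => u x * g x) volume ∧ T g = ∫ x, u x * g x

/-- The `L^p`-norm `∈ [0, ∞]` of a tempered distribution: the `L^p`-norm of the function `u` that
gives it (`u` is unique up to null sets), and `∞` if there is none. -/
noncomputable def lpNorm (p : ℝ≥0∞) (T : 𝓢'(Rd d, ℂ)) : ℝ≥0∞ :=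
  ⨅ (u : Rd d → ℂ) (_ : IsGivenBy T u), eLpNorm u p volume

end FourierDistributions

section Sequences

variable {ι : Type*}

/-- The weighted norm `‖(w_i c_i)_i‖_{ℓ^q} ∈ [0, ∞]` of a family `c` in `[0, ∞]`,
for `q ∈ [1, ∞]` and a weight `w` with positive values. -/
noncomputable def wlNorm (w : ι → ℝ) (q : ℝ≥0∞) (c : ι → ℝ≥0∞) : ℝ≥0∞ :=
  if q = ∞ then ⨆ i, ENNReal.ofReal (w i) * c i
  else (∑' i, (ENNReal.ofReal (w i) * c i) ^ q.toReal) ^ (1 / q.toReal)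

/-- `i^* = {ℓ : Q_ℓ ∩ Q_i ≠ ∅}`. -/
def starSet {X : Type*} (Q : ι → Set X) (i : ι) : Set ι := {l | (Q l ∩ Q i).Nonempty}

/-- The clustering map `Γ_Q`, `(Γ_Q c)_i = ∑_{ℓ ∈ i^*} c_ℓ` (a finite sum when `i^*` is
finite). -/
noncomputable def clustering {X : Type*} (Q : ι → Set X) (c : ι → ℂ) (i : ι) : ℂ :=
  ∑ᶠ l ∈ starSet Q i, c l

/-- The operator norm of `Γ_Q : ℓ^q_w(I) → ℓ^q_w(I)`, with values in `[0, ∞]`. -/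
noncomputable def clusteringNorm {X : Type*} (Q : ι → Set X) (w : ι → ℝ) (q : ℝ≥0∞) : ℝ≥0∞ :=
  sInf {C : ℝ≥0∞ | ∀ c : ι → ℂ, wlNorm w q (fun i => ‖c i‖ₑ) < ∞ →
    wlNorm w q (fun i => ‖clustering Q c i‖ₑ) ≤ C * wlNorm w q (fun i => ‖c i‖ₑ)}

end Sequences

section Spaces

variable {d : ℕ} {O : Opens (Rd d)} {ι : Type*}

/-- `Q = (Q_i)_{i ∈ I}` is an admissible cover of `O`. -/
structure IsAdmissibleCover (O : Opens (Rd d)) (Q : ι → Set (Rd d)) : Prop where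
  iUnion_eq : ⋃ i, Q i = (O : Set (Rd d))
  nonempty : ∀ i, (Q i).Nonempty
  card_star : ⨆ i, (starSet Q i).encard < ⊤

/-- `w` is a `Q`-moderate weight: `0 < w_i` and
`C_{w,Q} = sup_i sup_{ℓ ∈ i^*} w_i / w_ℓ < ∞`. -/
structure IsModerateWeight (Q : ι → Set (Rd d)) (w : ι → ℝ) : Prop where
  pos : ∀ i, 0 < w i
  moderate : ⨆ i, ⨆ l ∈ starSet Q i, ENNReal.ofReal (w i / w l) < ∞

/-- `C_Φ = sup_i ‖F⁻¹ φ_i‖_{L¹}`. -/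
noncomputable def bapuConst (Φ : ι → 𝓓(O, ℂ)) : ℝ≥0∞ :=
  ⨆ i, eLpNorm (𝓕⁻ (toSchwartz (Φ i)) : 𝓢(Rd d, ℂ)) 1 volume

/-- `Φ = (φ_i)_{i ∈ I}`, with `φ_i ∈ C_c^∞(O)`, is a bounded admissible partition of unity (BAPU)
subordinate to `Q`. -/
structure IsBAPU (Q : ι → Set (Rd d)) (Φ : ι → 𝓓(O, ℂ)) : Prop where
  hasSum_one : ∀ ξ ∈ O, HasSum (fun i => Φ i ξ) 1
  eq_zero : ∀ i, ∀ ξ ∈ (O : Set (Rd d)) \ Q i, Φ i ξ = 0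
  bounded : bapuConst Φ < ∞

/-- The norm `‖f‖_{D(Q, L^p, ℓ^q_w)} = ‖(‖F⁻¹(φ_i f̂)‖_{L^p})_i‖_{ℓ^q_w} ∈ [0, ∞]`. -/
noncomputable def decompNorm (Φ : ι → 𝓓(O, ℂ)) (w : ι → ℝ) (p q : ℝ≥0∞) (f : ZDual O) : ℝ≥0∞ :=
  wlNorm w q fun i => lpNorm p (piece (Φ i) f)

/-- The decomposition space `D(Q, L^p, ℓ^q_w) ⊆ Z'(O)`, formed with the BAPU `Φ` for `Q`. -/
def DecompSpace (Φ : ι → 𝓓(O, ℂ)) (w : ι → ℝ) (p q : ℝ≥0∞) : Set (ZDual O) :=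
  {f | decompNorm Φ w p q f < ∞}

/-- `‖F‖_{ℓ^q_w(I; L^p)} = ‖(‖F_i‖_{L^p})_i‖_{ℓ^q_w}`. -/
noncomputable def mixedNorm (w : ι → ℝ) (p q : ℝ≥0∞) (F : ι → Rd d → ℝ) : ℝ≥0∞ :=
  wlNorm w q fun i => eLpNorm (F i) p volume

/-- `F ∈ ℓ^q_w(I; L^p)`. -/
def MemMixed (w : ι → ℝ) (p q : ℝ≥0∞) (F : ι → Rd d → ℝ) : Prop :=
  (∀ i, MemLp (F i) p volume) ∧ mixedNorm w p q F < ∞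

/-- `f ∈ Z'(O)` is `(F, Φ)`-dominated: for every `i`, the smooth function that gives
`F⁻¹(φ_i f̂)` satisfies `|F⁻¹(φ_i f̂)| ≤ F_i` everywhere. -/
def IsDominated (F : ι → Rd d → ℝ) (Φ : ι → 𝓓(O, ℂ)) (f : ZDual O) : Prop :=
  ∀ i, ∃ u : Rd d → ℂ, ContDiff ℝ ((⊤ : ℕ∞) : WithTop ℕ∞) u ∧ IsGivenBy (piece (Φ i) f) u ∧ ∀ x, ‖u x‖ ≤ F i x

end Spaces

end DecompositionSpace

namespace DecompositionSpace

/-! ### Weighted sequence norms and the clustering operator -/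

section SequenceSpaces

variable {ι X : Type*}

/-! For `f` in the decomposition space let `u_i ∈ L^p` give `F⁻¹(φ_i f̂)`. Multiply `u_i` by `θ = F
ρ`, where `ρ` is a normalized bump supported in a small ball. On the Fourier side this mollifies
`φ_i f̂`: `F(θ u_i)` is smooth and lives on a small neighbourhood of `supp φ_i`, still inside `O`.
For a finite index set `J` the sum `H = ∑_{i ∈ J} F(θ u_i)` is therefore a test function, and `g =
F⁻¹ H` is the approximant. One sequence of such `g` serves both density and dominated approximation.

If the neighbourhoods are so small that they lie in `⋃_{k ∈ i^*} {φ_k ≠ 0}`, then only indices in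
`j^{**}` contribute to `φ_j H` (`IsBAPU.exists_regularization`). Hence `F⁻¹(φ_j H)` is the
convolution of `k_j = F⁻¹ φ_j` with `∑_{i ∈ j^{**} ∩ J} θ u_i`. Since `|θ| ≤ 1`, it is bounded
pointwise by `F_j = |k_j| * ∑_{i ∈ j^{**}} |u_i|`, which depends on neither `J` nor `ρ`. Young's
inequality costs `C_Φ`, and summing over `j^{**}` costs two applications of the clustering operator
(`wlNorm_sum_star₂_le`); this is the stated constant.

As the balls shrink, `θ → 1` pointwise, while `J` exhausts the index set, which is countable
(`countable_index`). Dominated convergence then gives convergence in `Z'(O)`. For finite `p` and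
`q`, using it in `L^p` and then in `ℓ^q` gives norm convergence (`tendsto_decompNorm_sub`).
Membership of `S_O` needs less: a test function meets only finitely many `φ_i`, and its pieces are
Schwartz functions. -/

theorem wlNorm_mono (w : ι → ℝ) (q : ℝ≥0∞) {c c' : ι → ℝ≥0∞} (h : ∀ i, c i ≤ c' i) :
    wlNorm w q c ≤ wlNorm w q c' := by
  unfold wlNorm
  split_ifs
  · exact iSup_mono fun i => mul_le_mul_right (h i) _
  · refine ENNReal.rpow_le_rpow (ENNReal.tsum_le_tsum fun i => ?_) (by positivity)
    exact ENNReal.rpow_le_rpow (mul_le_mul_right (h i) _) ENNReal.toReal_nonneg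

theorem one_le_toReal_of_one_le {q : ℝ≥0∞} (hq : 1 ≤ q) (hq' : q ≠ ∞) : 1 ≤ q.toReal := by
  simpa using (ENNReal.toReal_le_toReal ENNReal.one_ne_top hq').2 hq

theorem wlNorm_const_mul (w : ι → ℝ) {q : ℝ≥0∞} (hq : 1 ≤ q) (C : ℝ≥0∞) (c : ι → ℝ≥0∞) :
    wlNorm w q (fun i => C * c i) = C * wlNorm w q c := by
  unfold wlNorm
  split_ifs with h
  · rw [ENNReal.mul_iSup]
    exact iSup_congr fun i => mul_left_comm _ _ _
  · have hq1 := one_le_toReal_of_one_le hq h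
    have hq0 : 0 < q.toReal := by linarith
    have : ∀ i, (ENNReal.ofReal (w i) * (C * c i)) ^ q.toReal =
        C ^ q.toReal * (ENNReal.ofReal (w i) * c i) ^ q.toReal := fun i => by
      rw [mul_left_comm, ENNReal.mul_rpow_of_nonneg _ _ hq0.le]
    simp_rw [this]
    rw [ENNReal.tsum_mul_left, ENNReal.mul_rpow_of_nonneg _ _ (by positivity),
      ← ENNReal.rpow_mul, mul_one_div_cancel hq0.ne', ENNReal.rpow_one]

theorem le_wlNorm (w : ι → ℝ) {q : ℝ≥0∞} (hq : 1 ≤ q) (c : ι → ℝ≥0∞) (i : ι) :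
    ENNReal.ofReal (w i) * c i ≤ wlNorm w q c := by
  unfold wlNorm
  split_ifs with h
  · exact le_iSup (fun i => ENNReal.ofReal (w i) * c i) i
  · have hq1 := one_le_toReal_of_one_le hq h
    have hq0 : 0 < q.toReal := by linarith
    rw [one_div, ENNReal.le_rpow_inv_iff hq0]
    exact ENNReal.le_tsum (f := fun i => (ENNReal.ofReal (w i) * c i) ^ q.toReal) i

theorem lt_top_of_wlNorm_lt_top {w : ι → ℝ} (hw : ∀ i, 0 < w i) {q : ℝ≥0∞} (hq : 1 ≤ q)
    {c : ι → ℝ≥0∞} (hc : wlNorm w q c < ∞) (i : ι) : c i < ∞ := by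
  have h := (le_wlNorm w hq c i).trans_lt hc
  by_contra hi
  rw [not_lt, top_le_iff] at hi
  rw [hi, ENNReal.mul_top (by simpa using hw i)] at h
  exact lt_irrefl _ h

theorem wlNorm_lt_top_of_finite (w : ι → ℝ) {q : ℝ≥0∞} (hq : 1 ≤ q) {c : ι → ℝ≥0∞}
    (hfin : {i | c i ≠ 0}.Finite) (hc : ∀ i, c i < ∞) : wlNorm w q c < ∞ := by
  have hz : ∀ i ∉ hfin.toFinset, c i = 0 := fun i hi => by simpa using hi
  unfold wlNorm
  split_ifs with h
  · refine lt_of_le_of_lt (b := ∑ i ∈ hfin.toFinset, ENNReal.ofReal (w i) * c i)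
      (iSup_le fun i => ?_) (ENNReal.sum_lt_top.2 fun i _ => ENNReal.mul_lt_top
        ENNReal.ofReal_lt_top (hc i))
    by_cases hi : i ∈ hfin.toFinset
    · exact Finset.single_le_sum (f := fun i => ENNReal.ofReal (w i) * c i)
        (fun _ _ => zero_le) hi
    · simp [hz i hi]
  · have hq1 := one_le_toReal_of_one_le hq h
    have hq0 : 0 < q.toReal := by linarith
    rw [tsum_eq_sum (s := hfin.toFinset) fun i hi => by simp [hz i hi, hq0]]
    refine ENNReal.rpow_lt_top_of_nonneg (by positivity) (ENNReal.sum_lt_top.2 fun i _ => ?_).ne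
    exact ENNReal.rpow_lt_top_of_nonneg hq0.le
      (ENNReal.mul_lt_top ENNReal.ofReal_lt_top (hc i)).ne

theorem tendsto_wlNorm_of_dominated (w : ι → ℝ) {q : ℝ≥0∞} (hq : 1 ≤ q) (hq' : q < ∞)
    {a : ℕ → ι → ℝ≥0∞} {b : ι → ℝ≥0∞} (hab : ∀ n i, a n i ≤ b i) (hb : wlNorm w q b < ∞)
    (ha : ∀ i, Tendsto (fun n => a n i) atTop (𝓝 0)) :
    Tendsto (fun n => wlNorm w q (a n)) atTop (𝓝 0) := by
  have hq1 := one_le_toReal_of_one_le hq hq'.ne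
  have hq0 : 0 < q.toReal := by linarith
  simp only [wlNorm, if_neg hq'.ne] at hb ⊢
  -- With the discrete σ-algebra the sum is an integral against counting measure, so dominated
  -- convergence for integrals applies.
  let _ : MeasurableSpace ι := ⊤
  have hb' : ∑' i, (ENNReal.ofReal (w i) * b i) ^ q.toReal ≠ ∞ := fun h => by
    rw [h, ENNReal.top_rpow_of_pos (by positivity)] at hb
    exact lt_irrefl _ hb
  have hlim : Tendsto (fun n => ∑' i, (ENNReal.ofReal (w i) * a n i) ^ q.toReal) atTop (𝓝 0) := by
    simp_rw [← lintegral_count] at hb' ⊢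
    rw [← lintegral_zero (μ := (Measure.count : Measure ι))]
    refine tendsto_lintegral_of_dominated_convergence _ (fun n => measurable_from_top)
      (fun n => Eventually.of_forall fun i => ENNReal.rpow_le_rpow
        (mul_le_mul_right (hab n i) _) hq0.le) hb' (Eventually.of_forall fun i => ?_)
    have h1 := ENNReal.Tendsto.const_mul (a := ENNReal.ofReal (w i)) (ha i)
      (Or.inr ENNReal.ofReal_ne_top)
    have h2 := h1.ennrpow_const q.toReal
    simpa [hq0] using h2
  have h3 := hlim.ennrpow_const (1 / q.toReal)
  simpa [hq0] using h3

theorem mem_starSet_comm {Q : ι → Set X} {i l : ι} : l ∈ starSet Q i ↔ i ∈ starSet Q l := by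
  simp only [starSet, mem_ofPred_eq, inter_comm]

theorem exists_encard_starSet_le {Q : ι → Set X} (h : ⨆ i, (starSet Q i).encard < ⊤) :
    ∃ N : ℕ, ∀ i, (starSet Q i).encard ≤ N := by
  obtain ⟨N, hN⟩ := ENat.ne_top_iff_exists.1 h.ne
  exact ⟨N, fun i => hN ▸ le_iSup (fun i => (starSet Q i).encard) i⟩

theorem finite_starSet {Q : ι → Set X} (h : ⨆ i, (starSet Q i).encard < ⊤) (i : ι) :
    (starSet Q i).Finite :=
  Set.encard_lt_top_iff.1 ((le_iSup (fun i => (starSet Q i).encard) i).trans_lt h)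

theorem clustering_eq_sum {Q : ι → Set X} (hQ : ∀ i, (starSet Q i).Finite) (c : ι → ℂ) (i : ι) :
    clustering Q c i = ∑ l ∈ (hQ i).toFinset, c l :=
  finsum_mem_eq_finite_toFinset_sum _ _

/-- Double counting: the relation `l ∈ i^*` is symmetric, so each `a l` occurs once for every
element of `l^*`, hence at most `N` times. -/
theorem tsum_sum_starSet_le {Q : ι → Set X} (hQ : ∀ i, (starSet Q i).Finite) {N : ℕ}
    (hN : ∀ i, (starSet Q i).encard ≤ N) (a : ι → ℝ≥0∞) :
    ∑' i, ∑ l ∈ (hQ i).toFinset, a l ≤ N * ∑' l, a l := by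
  classical
  have h1 : ∀ i, ∑ l ∈ (hQ i).toFinset, a l = ∑' l, if l ∈ starSet Q i then a l else 0 :=
    fun i => by
      rw [tsum_eq_sum (s := (hQ i).toFinset) fun l hl => if_neg (by simpa using hl)]
      exact Finset.sum_congr rfl fun l hl => (if_pos (by simpa using hl)).symm
  simp_rw [h1]
  rw [ENNReal.tsum_comm, ← ENNReal.tsum_mul_left]
  refine ENNReal.tsum_le_tsum fun l => ?_
  rw [tsum_eq_sum (s := (hQ l).toFinset) fun i hi =>
    if_neg fun h => hi (by simpa using mem_starSet_comm.1 h)]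
  refine (Finset.sum_le_card_nsmul _ _ (a l) fun i _ => ?_).trans ?_
  · split_ifs <;> simp
  · rw [nsmul_eq_mul]
    gcongr
    have := hN l
    rw [(hQ l).encard_eq_coe_toFinset_card] at this
    exact_mod_cast this

/-- Moderateness moves the weight from `i` to its neighbours, and each cluster has at most `N`
members. This makes the operator norm of the clustering map finite. -/
theorem exists_wlNorm_clustering_le {Q : ι → Set X} (h : ⨆ i, (starSet Q i).encard < ⊤)
    {w : ι → ℝ} (hw : ∀ i, 0 < w i)
    (hmod : ⨆ i, ⨆ l ∈ starSet Q i, ENNReal.ofReal (w i / w l) < ∞) {q : ℝ≥0∞} (hq : 1 ≤ q) :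
    ∃ C : ℝ≥0∞, C < ∞ ∧ ∀ c : ι → ℂ, wlNorm w q (fun i => ‖clustering Q c i‖ₑ) ≤
      C * wlNorm w q (fun i => ‖c i‖ₑ) := by
  obtain ⟨N, hN⟩ := exists_encard_starSet_le h
  have hQ := finite_starSet h
  set M := ⨆ i, ⨆ l ∈ starSet Q i, ENNReal.ofReal (w i / w l)
  have hMw : ∀ i, ∀ l ∈ starSet Q i, ENNReal.ofReal (w i) ≤ M * ENNReal.ofReal (w l) := by
    intro i l hl
    have : ENNReal.ofReal (w i / w l) ≤ M :=
      le_iSup_of_le i (le_iSup₂_of_le (f := fun l _ => ENNReal.ofReal (w i / w l)) l hl le_rfl)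
    calc ENNReal.ofReal (w i) = ENNReal.ofReal (w i / w l) * ENNReal.ofReal (w l) := by
          rw [← ENNReal.ofReal_mul (by have := hw i; have := hw l; positivity),
            div_mul_cancel₀ _ (hw l).ne']
      _ ≤ _ := mul_le_mul_left this _
  have hcard : ∀ i, ((hQ i).toFinset.card : ℝ≥0∞) ≤ N := fun i => by
    have := hN i
    rw [(hQ i).encard_eq_coe_toFinset_card] at this
    exact_mod_cast this
  have hpt : ∀ (c : ι → ℂ) i, ENNReal.ofReal (w i) * ‖clustering Q c i‖ₑ ≤
      M * ∑ l ∈ (hQ i).toFinset, ENNReal.ofReal (w l) * ‖c l‖ₑ := by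
    intro c i
    rw [clustering_eq_sum hQ]
    refine (mul_le_mul_right (enorm_sum_le _ _) _).trans ?_
    rw [Finset.mul_sum, Finset.mul_sum]
    refine Finset.sum_le_sum fun l hl => ?_
    rw [← mul_assoc]
    exact mul_le_mul_left (hMw i l (by simpa using hl)) _
  unfold wlNorm
  split_ifs with hqt
  · refine ⟨M * N, ENNReal.mul_lt_top hmod (by simp), fun c => iSup_le fun i => (hpt c i).trans ?_⟩
    rw [mul_assoc]
    gcongr
    refine (Finset.sum_le_card_nsmul _ _ _ fun l _ =>
      le_iSup (fun l => ENNReal.ofReal (w l) * ‖c l‖ₑ) l).trans ?_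
    rw [nsmul_eq_mul]
    exact mul_le_mul_left (hcard i) _
  · have hq1 := one_le_toReal_of_one_le hq hqt
    have hq0 : 0 < q.toReal := by linarith
    set r := q.toReal
    -- `M ^ r` comes from moderateness, `N ^ (r - 1)` from the power mean inequality on a cluster,
    -- the last `N` from double counting.
    refine ⟨(M ^ r * ((N : ℝ≥0∞) ^ (r - 1) * N)) ^ (1 / r), ?_, fun c => ?_⟩
    · refine ENNReal.rpow_lt_top_of_nonneg (by positivity) (ENNReal.mul_lt_top ?_
        (ENNReal.mul_lt_top ?_ (by simp))).ne
      · exact ENNReal.rpow_lt_top_of_nonneg hq0.le hmod.ne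
      · exact ENNReal.rpow_lt_top_of_nonneg (by linarith) (by simp)
    · rw [← ENNReal.mul_rpow_of_nonneg _ _ (by positivity)]
      refine ENNReal.rpow_le_rpow ?_ (by positivity)
      calc ∑' i, (ENNReal.ofReal (w i) * ‖clustering Q c i‖ₑ) ^ r
          ≤ ∑' i, M ^ r * ((N : ℝ≥0∞) ^ (r - 1) *
              ∑ l ∈ (hQ i).toFinset, (ENNReal.ofReal (w l) * ‖c l‖ₑ) ^ r) := by
            refine ENNReal.tsum_le_tsum fun i => ?_
            refine (ENNReal.rpow_le_rpow (hpt c i) hq0.le).trans ?_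
            rw [ENNReal.mul_rpow_of_nonneg _ _ hq0.le]
            gcongr
            refine (ENNReal.rpow_sum_le_const_mul_sum_rpow _ _ hq1).trans ?_
            exact mul_le_mul_left (ENNReal.rpow_le_rpow (hcard i) (by linarith)) _
        _ ≤ _ := by
            rw [ENNReal.tsum_mul_left, ENNReal.tsum_mul_left, mul_assoc, mul_assoc]
            gcongr
            exact tsum_sum_starSet_le hQ hN _

theorem clusteringNorm_lt_top {Q : ι → Set X} (h : ⨆ i, (starSet Q i).encard < ⊤)
    {w : ι → ℝ} (hw : ∀ i, 0 < w i)
    (hmod : ⨆ i, ⨆ l ∈ starSet Q i, ENNReal.ofReal (w i / w l) < ∞) {q : ℝ≥0∞} (hq : 1 ≤ q) :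
    clusteringNorm Q w q < ∞ := by
  obtain ⟨C, hC, hle⟩ := exists_wlNorm_clustering_le h hw hmod hq
  have : clusteringNorm Q w q ≤ C := sInf_le fun c _ => hle c
  exact this.trans_lt hC

theorem wlNorm_clustering_le {Q : ι → Set X} {w : ι → ℝ} {q : ℝ≥0∞}
    (hfin : clusteringNorm Q w q < ∞) {c : ι → ℂ} (hc : wlNorm w q (fun i => ‖c i‖ₑ) < ∞) :
    wlNorm w q (fun i => ‖clustering Q c i‖ₑ) ≤
      clusteringNorm Q w q * wlNorm w q (fun i => ‖c i‖ₑ) := by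
  obtain ⟨C, hC, hCt⟩ := sInf_lt_iff.1 hfin
  rcases eq_or_ne (wlNorm w q (fun i => ‖c i‖ₑ)) 0 with h0 | h0
  · simpa [h0] using hC c hc
  · rw [← ENNReal.div_le_iff h0 hc.ne]
    exact le_sInf fun D hD => (ENNReal.div_le_iff h0 hc.ne).2 (hD c hc)

theorem sum_biUnion_le_sum {κ : Type*} [DecidableEq ι] (s : Finset κ) (t : κ → Finset ι)
    (a : ι → ℝ≥0∞) : ∑ i ∈ s.biUnion t, a i ≤ ∑ k ∈ s, ∑ i ∈ t k, a i := by
  classical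
  induction s using Finset.induction_on with
  | empty => simp
  | insert k s hk ih =>
    rw [Finset.biUnion_insert, Finset.sum_insert hk]
    refine le_trans ?_ (add_le_add_right ih _)
    rw [← Finset.sum_union_inter]
    exact le_self_add

/-- The indices in the second-order neighbourhood `j^{**} = ⋃_{k ∈ j^*} k^*`. -/
noncomputable def star₂ {Q : ι → Set X} (hQ : ∀ i, (starSet Q i).Finite) (j : ι) : Finset ι :=
  open Classical in (hQ j).toFinset.biUnion fun k => (hQ k).toFinset

theorem mem_star₂ {Q : ι → Set X} (hQ : ∀ i, (starSet Q i).Finite) {i j : ι} :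
    i ∈ star₂ hQ j ↔ ∃ k ∈ starSet Q j, i ∈ starSet Q k := by
  simp [star₂]

/-- Every `i ∈ j^{**}` occurs at least once in the double sum that defines `Γ(Γ a)_j`; this is where
the square of the operator norm arises. -/
theorem wlNorm_sum_star₂_le {Q : ι → Set X} (hQ : ∀ i, (starSet Q i).Finite) {w : ι → ℝ}
    (hw : ∀ i, 0 < w i) {q : ℝ≥0∞} (hq : 1 ≤ q) (hfin : clusteringNorm Q w q < ∞) {a : ι → ℝ≥0∞}
    (ha : wlNorm w q a < ∞) :
    wlNorm w q (fun j => ∑ i ∈ star₂ hQ j, a i) ≤ clusteringNorm Q w q ^ 2 * wlNorm w q a := by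
  classical
  have hat := lt_top_of_wlNorm_lt_top hw hq ha
  -- The clustering map acts on complex families; since `a` is finite everywhere, nothing is lost in
  -- passing to them.
  let c : ι → ℂ := fun i => ((a i).toReal : ℂ)
  have hc : (fun i => ‖c i‖ₑ) = a := by
    funext i
    simp only [c, ← ofReal_norm, Complex.norm_real, Real.norm_eq_abs,
      abs_of_nonneg ENNReal.toReal_nonneg]
    exact ENNReal.ofReal_toReal (hat i).ne
  have h1 : ∀ j, ∑ i ∈ star₂ hQ j, a i ≤ ‖clustering Q (clustering Q c) j‖ₑ := by
    intro j
    have : clustering Q (clustering Q c) j =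
        ((∑ k ∈ (hQ j).toFinset, ∑ i ∈ (hQ k).toFinset, (a i).toReal : ℝ) : ℂ) := by
      simp [clustering_eq_sum hQ, c]
    rw [this, ← ofReal_norm, Complex.norm_real, Real.norm_eq_abs, abs_of_nonneg
      (Finset.sum_nonneg fun _ _ => Finset.sum_nonneg fun _ _ => ENNReal.toReal_nonneg),
      ENNReal.ofReal_sum_of_nonneg fun _ _ => Finset.sum_nonneg fun _ _ => ENNReal.toReal_nonneg]
    have h2 : ∀ k, ENNReal.ofReal (∑ i ∈ (hQ k).toFinset, (a i).toReal) =
        ∑ i ∈ (hQ k).toFinset, a i := fun k => by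
      rw [ENNReal.ofReal_sum_of_nonneg fun _ _ => ENNReal.toReal_nonneg]
      exact Finset.sum_congr rfl fun i _ => ENNReal.ofReal_toReal (hat i).ne
    simp_rw [h2]
    exact sum_biUnion_le_sum _ _ _
  have hc' : wlNorm w q (fun i => ‖c i‖ₑ) < ∞ := by rwa [hc]
  have hΓ := wlNorm_clustering_le hfin hc'
  have hΓ' : wlNorm w q (fun i => ‖clustering Q c i‖ₑ) < ∞ :=
    hΓ.trans_lt (ENNReal.mul_lt_top hfin hc')
  calc _ ≤ wlNorm w q (fun j => ‖clustering Q (clustering Q c) j‖ₑ) := wlNorm_mono w q h1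
    _ ≤ _ := wlNorm_clustering_le hfin hΓ'
    _ ≤ clusteringNorm Q w q * (clusteringNorm Q w q * wlNorm w q (fun i => ‖c i‖ₑ)) := by gcongr
    _ = _ := by rw [hc, sq, mul_assoc]

end SequenceSpaces

/-! ### Convolution with Schwartz kernels: Young and Fubini -/

section Convolution

variable {d : ℕ}

/-- Hölder applied to `K V = K^(1 - 1/r) (K V^r)^(1/r)` gives a pointwise bound; Tonelli and
translation invariance do the rest. -/
theorem lintegral_conv_rpow_le {K V : Rd d → ℝ≥0∞} (hK : Measurable K) (hV : AEMeasurable V)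
    {r : ℝ} (hr : 1 ≤ r) :
    ∫⁻ x, (∫⁻ y, K (x - y) * V y) ^ r ≤ (∫⁻ y, K y) ^ r * ∫⁻ y, V y ^ r := by
  have hr0 : 0 < r := by linarith
  have hr1 : 0 ≤ 1 - 1 / r := by
    rw [sub_nonneg, div_le_one hr0]
    exact hr
  have hKx : ∀ x : Rd d, Measurable fun y => K (x - y) := fun x => by fun_prop
  have hKi : ∀ x : Rd d, ∫⁻ y, K (x - y) = ∫⁻ y, K y := fun x =>
    lintegral_sub_left_eq_self K x
  have hpt : ∀ x : Rd d, (∫⁻ y, K (x - y) * V y) ^ r ≤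
      (∫⁻ y, K y) ^ (r - 1) * ∫⁻ y, K (x - y) * V y ^ r := by
    intro x
    have h1 := ENNReal.lintegral_mul_norm_pow_le (μ := volume) (hKx x).aemeasurable
      ((hKx x).aemeasurable.mul (hV.pow_const r)) hr1 (q := 1 / r) (by positivity) (by ring)
    have h2 : ∀ y, K (x - y) ^ (1 - 1 / r) * (K (x - y) * V y ^ r) ^ (1 / r) =
        K (x - y) * V y := fun y => by
      rw [ENNReal.mul_rpow_of_nonneg _ _ (by positivity), ← mul_assoc,
        ← ENNReal.rpow_add_of_nonneg _ _ hr1 (by positivity), ← ENNReal.rpow_mul,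
        mul_one_div_cancel hr0.ne']
      simp
    simp only [Pi.mul_apply] at h1
    simp_rw [h2, hKi x] at h1
    refine (ENNReal.rpow_le_rpow h1 hr0.le).trans_eq ?_
    rw [ENNReal.mul_rpow_of_nonneg _ _ hr0.le, ← ENNReal.rpow_mul, ← ENNReal.rpow_mul,
      one_div_mul_cancel hr0.ne', ENNReal.rpow_one, sub_mul, one_mul, one_div_mul_cancel hr0.ne']
  have hprod : AEMeasurable (fun z : Rd d × Rd d => K (z.1 - z.2) * V z.2 ^ r)
      (volume.prod volume) := by
    refine AEMeasurable.mul (hK.comp (measurable_fst.sub measurable_snd)).aemeasurable ?_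
    exact (hV.comp_quasiMeasurePreserving Measure.quasiMeasurePreserving_snd).pow_const r
  calc ∫⁻ x, (∫⁻ y, K (x - y) * V y) ^ r
      ≤ ∫⁻ x, (∫⁻ y, K y) ^ (r - 1) * ∫⁻ y, K (x - y) * V y ^ r := lintegral_mono hpt
    _ = (∫⁻ y, K y) ^ (r - 1) * ∫⁻ x, ∫⁻ y, K (x - y) * V y ^ r :=
        lintegral_const_mul'' _ hprod.lintegral_prod_right'
    _ = (∫⁻ y, K y) ^ (r - 1) * ∫⁻ y, ∫⁻ x, K (x - y) * V y ^ r := by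
        rw [lintegral_lintegral_swap hprod]
    _ = (∫⁻ y, K y) ^ (r - 1) * ∫⁻ y, (∫⁻ x, K x) * V y ^ r := by
        congr 1
        refine lintegral_congr fun y => ?_
        rw [lintegral_mul_const _ (by fun_prop), lintegral_sub_right_eq_self K y]
    _ = _ := by
        rw [lintegral_const_mul'' _ (hV.pow_const r), ← mul_assoc]
        congr 1
        nth_rewrite 2 [← ENNReal.rpow_one (∫⁻ x, K x)]
        rw [← ENNReal.rpow_add_of_nonneg _ _ (by linarith) zero_le_one, sub_add_cancel]

/-- **Young's inequality** `L¹ * L^p ⊆ L^p`, for any function dominated by the convolution. -/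
theorem eLpNorm_le_of_enorm_le_conv {E₁ E₂ E₃ : Type*} [NormedAddCommGroup E₁]
    [NormedAddCommGroup E₂] [NormedAddCommGroup E₃] {k : Rd d → E₁} {v : Rd d → E₂}
    {F : Rd d → E₃} (hk : Continuous k) (hv : AEStronglyMeasurable v) {p : ℝ≥0∞} (hp : 1 ≤ p)
    (hF : ∀ x, ‖F x‖ₑ ≤ ∫⁻ y, ‖k (x - y)‖ₑ * ‖v y‖ₑ) :
    eLpNorm F p volume ≤ eLpNorm k 1 volume * eLpNorm v p volume := by
  have hkm : Measurable fun y => ‖k y‖ₑ := hk.enorm.measurable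
  rw [eLpNorm_one_eq_lintegral_enorm]
  rcases eq_or_ne p ∞ with rfl | hpt
  · rw [eLpNorm_exponent_top, eLpNorm_exponent_top]
    refine eLpNormEssSup_le_of_ae_enorm_bound (Eventually.of_forall fun x => (hF x).trans ?_)
    calc ∫⁻ y, ‖k (x - y)‖ₑ * ‖v y‖ₑ ≤ ∫⁻ y, ‖k (x - y)‖ₑ * eLpNormEssSup v volume := by
          refine lintegral_mono_ae ?_
          filter_upwards [enorm_ae_le_eLpNormEssSup v volume] with y hy
          exact mul_le_mul_right hy _
      _ = _ := by
          have hkx : Measurable fun y => ‖k (x - y)‖ₑ :=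
            (hk.comp (continuous_const.sub continuous_id)).enorm.measurable
          rw [lintegral_mul_const _ hkx, lintegral_sub_left_eq_self (fun y => ‖k y‖ₑ) x]
  · have hp0 : p ≠ 0 := (zero_lt_one.trans_le hp).ne'
    have hr : 1 ≤ p.toReal := by
      simpa using (ENNReal.toReal_le_toReal ENNReal.one_ne_top hpt).2 hp
    have hr0 : 0 < p.toReal := by linarith
    rw [eLpNorm_eq_lintegral_rpow_enorm_toReal hp0 hpt,
      eLpNorm_eq_lintegral_rpow_enorm_toReal hp0 hpt]
    calc (∫⁻ x, ‖F x‖ₑ ^ p.toReal) ^ (1 / p.toReal)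
        ≤ ((∫⁻ y, ‖k y‖ₑ) ^ p.toReal * ∫⁻ y, ‖v y‖ₑ ^ p.toReal) ^ (1 / p.toReal) := by
          refine ENNReal.rpow_le_rpow ?_ (by positivity)
          refine le_trans (lintegral_mono fun x => ENNReal.rpow_le_rpow (hF x) hr0.le) ?_
          exact lintegral_conv_rpow_le hkm hv.enorm hr
      _ = _ := by
          rw [ENNReal.mul_rpow_of_nonneg _ _ (by positivity), ← ENNReal.rpow_mul,
            mul_one_div_cancel hr0.ne', ENNReal.rpow_one]

theorem integrable_mul_of_memLp {k G : Rd d → ℂ} {p : ℝ≥0∞} (hp : 1 ≤ p)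
    (hk : ∀ q : ℝ≥0∞, MemLp k q volume) (hG : MemLp G p volume) :
    Integrable (fun y => k y * G y) := by
  have : ENNReal.HolderConjugate p (ENNReal.conjExponent p) := .conjExponent hp
  exact (hk (ENNReal.conjExponent p)).integrable_mul (p := ENNReal.conjExponent p) (q := p) hG

theorem memLp_sub_left (k : 𝓢(Rd d, ℂ)) (x : Rd d) (q : ℝ≥0∞) :
    MemLp (fun y => k (x - y)) q volume :=
  (k.memLp q volume).comp_measurePreserving (Measure.measurePreserving_sub_left volume x)

theorem integrable_conv (k : 𝓢(Rd d, ℂ)) {G : Rd d → ℂ} {p : ℝ≥0∞} (hp : 1 ≤ p)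
    (hG : MemLp G p volume) (x : Rd d) : Integrable (fun y => k (x - y) * G y) :=
  integrable_mul_of_memLp hp (memLp_sub_left k x) hG

theorem aestronglyMeasurable_conv_integrand (k : 𝓢(Rd d, ℂ)) {G : Rd d → ℂ}
    (hG : AEStronglyMeasurable G) :
    AEStronglyMeasurable (fun z : Rd d × Rd d => k (z.1 - z.2) * G z.2) (volume.prod volume) := by
  refine AEStronglyMeasurable.mul ?_
    (hG.comp_quasiMeasurePreserving Measure.quasiMeasurePreserving_snd)
  exact (k.continuous.comp (continuous_fst.sub continuous_snd)).aestronglyMeasurable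

/-- The convolution `k * G` of a Schwartz function with a function in some `L^p`. -/
noncomputable def conv (k : 𝓢(Rd d, ℂ)) (G : Rd d → ℂ) (x : Rd d) : ℂ := ∫ y, k (x - y) * G y

/-- The convolution `|k| * V` of the modulus of a Schwartz function with a real function. -/
noncomputable def absConv (k : 𝓢(Rd d, ℂ)) (V : Rd d → ℝ) (x : Rd d) : ℝ :=
  ∫ y, ‖k (x - y)‖ * V y

theorem enorm_conv_le (k : 𝓢(Rd d, ℂ)) (G : Rd d → ℂ) (x : Rd d) :
    ‖conv k G x‖ₑ ≤ ∫⁻ y, ‖k (x - y)‖ₑ * ‖G y‖ₑ := by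
  refine (enorm_integral_le_lintegral_enorm _).trans_eq ?_
  simp only [enorm_mul]

theorem enorm_absConv_le (k : 𝓢(Rd d, ℂ)) (V : Rd d → ℝ) (x : Rd d) :
    ‖absConv k V x‖ₑ ≤ ∫⁻ y, ‖k (x - y)‖ₑ * ‖V y‖ₑ := by
  refine (enorm_integral_le_lintegral_enorm _).trans_eq ?_
  simp only [enorm_mul, enorm_norm]

theorem memLp_conv (k : 𝓢(Rd d, ℂ)) {G : Rd d → ℂ} {p : ℝ≥0∞} (hp : 1 ≤ p)
    (hG : MemLp G p volume) : MemLp (conv k G) p volume := by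
  refine ⟨(aestronglyMeasurable_conv_integrand k hG.1).integral_prod_right', ?_⟩
  exact (eLpNorm_le_of_enorm_le_conv k.continuous hG.1 hp (enorm_conv_le k G)).trans_lt
    (ENNReal.mul_lt_top (k.memLp 1 volume).2 hG.2)

theorem aestronglyMeasurable_absConv (k : 𝓢(Rd d, ℂ)) {V : Rd d → ℝ}
    (hV : AEStronglyMeasurable V) : AEStronglyMeasurable (absConv k V) := by
  refine AEStronglyMeasurable.integral_prod_right'
    (f := fun z : Rd d × Rd d => ‖k (z.1 - z.2)‖ * V z.2) ?_
  refine AEStronglyMeasurable.mul ?_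
    (hV.comp_quasiMeasurePreserving Measure.quasiMeasurePreserving_snd)
  exact (k.continuous.comp (continuous_fst.sub continuous_snd)).norm.aestronglyMeasurable

theorem memLp_absConv (k : 𝓢(Rd d, ℂ)) {V : Rd d → ℝ} {p : ℝ≥0∞} (hp : 1 ≤ p)
    (hV : MemLp V p volume) : MemLp (absConv k V) p volume := by
  refine ⟨aestronglyMeasurable_absConv k hV.1, ?_⟩
  exact (eLpNorm_le_of_enorm_le_conv k.continuous hV.1 hp (enorm_absConv_le k V)).trans_lt
    (ENNReal.mul_lt_top (k.memLp 1 volume).2 hV.2)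

theorem norm_conv_le_absConv (k : 𝓢(Rd d, ℂ)) {G : Rd d → ℂ} {V : Rd d → ℝ} {p : ℝ≥0∞}
    (hp : 1 ≤ p) (hV : MemLp V p volume) (hGV : ∀ y, ‖G y‖ ≤ V y) (x : Rd d) :
    ‖conv k G x‖ ≤ absConv k V x := by
  refine norm_integral_le_of_norm_le ?_ (Eventually.of_forall fun y => ?_)
  · have h := (integrable_conv k hp hV.ofReal x).norm
    refine h.congr (Eventually.of_forall fun y => ?_)
    simp only [norm_mul, RCLike.norm_ofReal]
    rw [abs_of_nonneg ((norm_nonneg _).trans (hGV y))]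
  · rw [norm_mul]
    exact mul_le_mul_of_nonneg_left (hGV y) (norm_nonneg _)

/-- Integrating the modulus over the second variable leaves `|s|` times `|k| * |G|`. The latter is
in `L^p` by Young, so its product with a Schwartz function is integrable. -/
theorem integrable_conv_mul_prod (k s : 𝓢(Rd d, ℂ)) {G : Rd d → ℂ} {p : ℝ≥0∞} (hp : 1 ≤ p)
    (hG : MemLp G p volume) :
    Integrable (fun z : Rd d × Rd d => k (z.1 - z.2) * G z.2 * s z.1) (volume.prod volume) := by
  have hm : AEStronglyMeasurable (fun z : Rd d × Rd d => k (z.1 - z.2) * G z.2 * s z.1)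
      (volume.prod volume) :=
    (aestronglyMeasurable_conv_integrand k hG.1).mul
      (s.continuous.comp continuous_fst).aestronglyMeasurable
  rw [integrable_prod_iff hm]
  refine ⟨Eventually.of_forall fun x => (integrable_conv k hp hG x).mul_const (s x), ?_⟩
  have h1 := integrable_mul_of_memLp hp (fun q => s.memLp q volume)
    (memLp_absConv k hp hG.norm).ofReal
  refine h1.norm.congr (Eventually.of_forall fun x => ?_)
  simp only [norm_mul, RCLike.norm_ofReal]
  rw [integral_mul_const, mul_comm]
  congr 1
  exact abs_of_nonneg (integral_nonneg fun y => by positivity)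

theorem integral_conv_mul (k s : 𝓢(Rd d, ℂ)) {G : Rd d → ℂ} {p : ℝ≥0∞} (hp : 1 ≤ p)
    (hG : MemLp G p volume) :
    ∫ x, conv k G x * s x = ∫ y, G y * ∫ x, k (x - y) * s x := by
  have h := integral_integral_swap (f := fun x y : Rd d => k (x - y) * G y * s x)
    (integrable_conv_mul_prod k s hp hG)
  simp only [conv, ← integral_mul_const, ← integral_const_mul]
  refine h.trans (integral_congr_ae (Eventually.of_forall fun y => ?_))
  exact integral_congr_ae (Eventually.of_forall fun x => by ring)

end Convolution

/-! ### Multiplication formula and convolution identities for integrable functions -/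

section Fourier

variable {d : ℕ}

theorem integral_fourier_mul_of_integrable {f g : Rd d → ℂ} (hf : Integrable f)
    (hg : Integrable g) : ∫ ξ, 𝓕 f ξ * g ξ = ∫ x, f x * 𝓕 g x := by
  simpa using! VectorFourier.integral_fourierIntegral_smul_eq_flip (L := innerₗ (Rd d))
    Real.continuous_fourierChar continuous_inner hf hg

theorem integral_fourierInv_mul_of_integrable {f g : Rd d → ℂ} (hf : Integrable f)
    (hg : Integrable g) : ∫ ξ, 𝓕⁻ f ξ * g ξ = ∫ x, f x * 𝓕⁻ g x := by
  have h := integral_fourier_mul_of_integrable hf hg.comp_neg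
  rw [← Real.fourierInv_eq_fourier_comp_neg] at h
  rw [← h, ← integral_neg_eq_self]
  exact integral_congr_ae (Eventually.of_forall fun ξ => by
    simp [Real.fourierInv_eq_fourier_neg])

theorem norm_fourier_le_integral_norm (f : Rd d → ℂ) (x : Rd d) : ‖𝓕 f x‖ ≤ ∫ y, ‖f y‖ :=
  VectorFourier.norm_fourierIntegral_le_integral_norm _ _ _ f x

theorem integrable_fourierChar_mul {f : Rd d → ℂ} (hf : Integrable f) {a : Rd d → ℝ}
    (ha : Continuous a) : Integrable fun ξ => (Real.fourierChar (a ξ) : ℂ) * f ξ := by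
  have hc : Continuous fun ξ => (Real.fourierChar (a ξ) : ℂ) :=
    continuous_subtype_val.comp (Real.continuous_fourierChar.comp ha)
  exact hf.bdd_mul (c := 1) hc.aestronglyMeasurable (Eventually.of_forall fun ξ =>
    (Circle.norm_coe (Real.fourierChar (a ξ))).le)

theorem fourier_char_mul (f : Rd d → ℂ) (x y : Rd d) :
    𝓕 (fun ξ => (Real.fourierChar (inner ℝ ξ x) : ℂ) * f ξ) y = 𝓕⁻ f (x - y) := by
  rw [Real.fourier_eq, Real.fourierInv_eq]
  refine integral_congr_ae (Eventually.of_forall fun ξ => ?_)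
  simp only [Circle.smul_def, smul_eq_mul]
  rw [← mul_assoc, ← Circle.coe_mul, ← AddChar.map_add_eq_mul, inner_sub_right, neg_add_eq_sub]

theorem fourierInv_char_mul (f : Rd d → ℂ) (x y : Rd d) :
    𝓕⁻ (fun ξ => (Real.fourierChar (-inner ℝ ξ y) : ℂ) * f ξ) x = 𝓕⁻ f (x - y) := by
  rw [Real.fourierInv_eq, Real.fourierInv_eq]
  refine integral_congr_ae (Eventually.of_forall fun ξ => ?_)
  simp only [Circle.smul_def, smul_eq_mul]
  rw [← mul_assoc, ← Circle.coe_mul, ← AddChar.map_add_eq_mul, inner_sub_right]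
  congr 4

/-- `F(φ F⁻¹ g)(y) = ∫ k(x - y) g(x) dx` for `k = F⁻¹ φ`. -/
theorem fourier_mul_fourierInv {φ g : Rd d → ℂ} (hφ : Integrable φ) (hg : Integrable g)
    (y : Rd d) : 𝓕 (fun ξ => φ ξ * 𝓕⁻ g ξ) y = ∫ x, 𝓕⁻ φ (x - y) * g x := by
  -- The multiplication formula is applied to a modulated `φ`, whose inverse transform is a
  -- translate of `F⁻¹ φ`.
  have h := integral_fourierInv_mul_of_integrable
    (integrable_fourierChar_mul hφ (a := fun ξ => -inner ℝ ξ y) (by fun_prop)) hg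
  simp_rw [fourierInv_char_mul] at h
  rw [h, Real.fourier_eq]
  refine integral_congr_ae (Eventually.of_forall fun ξ => ?_)
  simp only [Circle.smul_def, smul_eq_mul, mul_assoc]

/-- `F⁻¹(φ F G)(x) = ∫ k(x - y) G(y) dy` for `k = F⁻¹ φ`. -/
theorem fourierInv_mul_fourier {φ G : Rd d → ℂ} (hφ : Integrable φ) (hG : Integrable G)
    (x : Rd d) : 𝓕⁻ (fun ξ => φ ξ * 𝓕 G ξ) x = ∫ y, 𝓕⁻ φ (x - y) * G y := by
  have h := integral_fourier_mul_of_integrable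
    (integrable_fourierChar_mul hφ (a := fun ξ => inner ℝ ξ x) (by fun_prop)) hG
  simp_rw [fourier_char_mul] at h
  rw [h, Real.fourierInv_eq]
  refine integral_congr_ae (Eventually.of_forall fun ξ => ?_)
  simp only [Circle.smul_def, smul_eq_mul, mul_assoc]

end Fourier

/-! ### Mollifiers and the multipliers they induce -/

section Mollifier

variable {d : ℕ}

/-- The translate by `ξ` of a normalized bump function, as a Schwartz function. -/
noncomputable def mollifier (b : ContDiffBump (0 : Rd d)) (ξ : Rd d) : 𝓢(Rd d, ℂ) :=
  HasCompactSupport.toSchwartzMap (f := fun η => ((b.normed volume (η - ξ) : ℝ) : ℂ))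
    (by
      have h : HasCompactSupport fun η => b.normed volume (η - ξ) :=
        (b.hasCompactSupport_normed (μ := volume)).comp_homeomorph (Homeomorph.subRight ξ)
      exact h.comp_left (g := fun t : ℝ => (t : ℂ)) Complex.ofReal_zero)
    (Complex.ofRealCLM.contDiff.comp (b.contDiff_normed.comp (contDiff_id.sub contDiff_const)))

theorem mollifier_apply (b : ContDiffBump (0 : Rd d)) (ξ η : Rd d) :
    mollifier b ξ η = (b.normed volume (η - ξ) : ℝ) := rfl

/-- The multiplier `θ = F ρ` attached to a normalized bump function `ρ`. -/
noncomputable def multiplier (b : ContDiffBump (0 : Rd d)) : 𝓢(Rd d, ℂ) := 𝓕 (mollifier b 0)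

/-- `ρ ≥ 0` and `∫ ρ = 1`. The bound being exactly `1`, the multiplier adds no factor to the final
constant. -/
theorem norm_multiplier_le (b : ContDiffBump (0 : Rd d)) (x : Rd d) : ‖multiplier b x‖ ≤ 1 := by
  rw [multiplier, SchwartzMap.fourier_coe]
  refine (norm_fourier_le_integral_norm _ x).trans_eq ?_
  rw [← b.integral_normed (μ := volume)]
  refine integral_congr_ae (Eventually.of_forall fun η => ?_)
  simp only [mollifier_apply, sub_zero, Complex.norm_real, Real.norm_eq_abs,
    abs_of_nonneg (b.nonneg_normed (μ := volume) η)]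

theorem tendsto_multiplier {b : ℕ → ContDiffBump (0 : Rd d)}
    (hb : Tendsto (fun n => (b n).rOut) atTop (𝓝 0)) (x : Rd d) :
    Tendsto (fun n => multiplier (b n) x) atTop (𝓝 1) := by
  have hg : Continuous fun η : Rd d => (Real.fourierChar (inner ℝ η x) : ℂ) :=
    continuous_subtype_val.comp (Real.continuous_fourierChar.comp (by fun_prop))
  -- `θ(x)` is the convolution at `0` of `ρ` with the character `η ↦ e(⟨η, x⟩)`, whose value at `0`
  -- is `1`.
  have h := ContDiffBump.convolution_tendsto_right_of_continuous (μ := volume) hb hg 0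
  simp only [inner_zero_left, AddChar.map_zero_eq_one, Circle.coe_one] at h
  refine h.congr fun n => ?_
  rw [multiplier, SchwartzMap.fourier_coe, Real.fourier_eq, convolution_def]
  refine integral_congr_ae (Eventually.of_forall fun η => ?_)
  simp [mollifier_apply, Circle.smul_def, mul_comm]

theorem fourier_mollifier (b : ContDiffBump (0 : Rd d)) (ξ x : Rd d) :
    𝓕 (mollifier b ξ) x = (Real.fourierChar (-inner ℝ x ξ) : ℂ) * multiplier b x := by
  rw [multiplier, SchwartzMap.fourier_coe, SchwartzMap.fourier_coe, Real.fourier_eq,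
    Real.fourier_eq, ← integral_const_mul,
    ← integral_add_right_eq_self (μ := volume) _ ξ]
  refine integral_congr_ae (Eventually.of_forall fun η => ?_)
  simp only [mollifier_apply, Circle.smul_def, smul_eq_mul, add_sub_cancel_right, sub_zero]
  rw [← mul_assoc, ← Circle.coe_mul, ← AddChar.map_add_eq_mul, inner_add_left,
    real_inner_comm x ξ]
  congr 4
  ring

end Mollifier

/-! ### Regularizing a single piece -/

section Regularize

variable {d : ℕ} {O : Opens (Rd d)}

theorem integrable_multiplier_mul (b : ContDiffBump (0 : Rd d)) {u : Rd d → ℂ} {p : ℝ≥0∞}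
    (hp : 1 ≤ p) (hu : MemLp u p volume) : Integrable fun x => multiplier b x * u x :=
  integrable_mul_of_memLp hp (fun q => (multiplier b).memLp q volume) hu

theorem integrable_pow_mul_schwartz_mul (s : 𝓢(Rd d, ℂ)) {u : Rd d → ℂ} {p : ℝ≥0∞} (hp : 1 ≤ p)
    (hu : MemLp u p volume) (n : ℕ) : Integrable fun x => ‖x‖ ^ n * ‖s x * u x‖ := by
  -- Unlike `‖x‖ ^ n`, this weight is always smooth, so the Schwartz factor absorbs it; it also
  -- dominates `‖x‖ ^ n`.
  have ht : (fun x : Rd d => (1 + ‖x‖ ^ 2) ^ n).HasTemperateGrowth := by fun_prop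
  have h := integrable_mul_of_memLp hp
    (fun q => (SchwartzMap.smulLeftCLM ℂ (fun x : Rd d => (1 + ‖x‖ ^ 2) ^ n) s).memLp q volume) hu
  refine h.mono ?_ (Eventually.of_forall fun x => ?_)
  · exact (continuous_norm.pow n).aestronglyMeasurable.mul
      (s.continuous.aestronglyMeasurable.mul hu.1).norm
  · rw [SchwartzMap.smulLeftCLM_apply_apply ht]
    have h1 : ‖x‖ ≤ 1 + ‖x‖ ^ 2 := by nlinarith [sq_nonneg (‖x‖ - 1), sq_nonneg ‖x‖]
    have h2 : ‖((1 + ‖x‖ ^ 2) ^ n : ℝ)‖ = (1 + ‖x‖ ^ 2) ^ n :=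
      Real.norm_of_nonneg (by positivity)
    rw [norm_mul, norm_pow, norm_norm, norm_norm, norm_mul, norm_mul, norm_smul, h2, mul_assoc]
    gcongr

theorem contDiff_fourier_schwartz_mul (s : 𝓢(Rd d, ℂ)) {u : Rd d → ℂ} {p : ℝ≥0∞} (hp : 1 ≤ p)
    (hu : MemLp u p volume) : ContDiff ℝ ((⊤ : ℕ∞) : WithTop ℕ∞) (𝓕 fun x => s x * u x) :=
  Real.contDiff_fourier fun n _ => integrable_pow_mul_schwartz_mul s hp hu n

/-- Mollification of a distribution: the value at `ξ` is `φ f̂` tested against the bump centred at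
`ξ`. It follows by testing `u` against the transform of that bump. -/
theorem fourier_multiplier_mul_eq {φ : 𝓓(O, ℂ)} {f : ZDual O} {u : Rd d → ℂ}
    (hu : IsGivenBy (piece φ f) u) (b : ContDiffBump (0 : Rd d)) (ξ : Rd d) :
    𝓕 (fun x => multiplier b x * u x) ξ = f (ZSpace.fourier O (mulTest φ (mollifier b ξ))) := by
  have h := (hu (𝓕 (mollifier b ξ))).2
  rw [piece_apply, FourierTransform.fourierInv_fourier_eq] at h
  rw [h, Real.fourier_eq]
  refine integral_congr_ae (Eventually.of_forall fun x => ?_)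
  simp only [Circle.smul_def, smul_eq_mul]
  rw [fourier_mollifier]
  ring

/-- The bump centred at such a `ξ` does not meet the support of `φ`, so the function on which `f̂`
is evaluated is zero. -/
theorem fourier_multiplier_mul_eq_zero {φ : 𝓓(O, ℂ)} {f : ZDual O} {u : Rd d → ℂ}
    (hu : IsGivenBy (piece φ f) u) (b : ContDiffBump (0 : Rd d)) {ξ : Rd d}
    (hξ : ξ ∉ Metric.cthickening b.rOut (tsupport φ)) :
    𝓕 (fun x => multiplier b x * u x) ξ = 0 := by
  rw [fourier_multiplier_mul_eq hu]
  have : mulTest φ (mollifier b ξ) = 0 := by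
    ext η
    change φ η * mollifier b ξ η = 0
    by_cases hη : φ η = 0
    · rw [hη, zero_mul]
    · have h0 : b.normed volume (η - ξ) = 0 := by
        by_contra h
        have hs : η - ξ ∈ Function.support (b.normed volume) := h
        rw [b.support_normed_eq, Metric.mem_ball, dist_zero_right, ← dist_eq_norm] at hs
        refine hξ (Metric.thickening_subset_cthickening _ _ (Metric.mem_thickening_iff.2
          ⟨η, subset_tsupport φ hη, ?_⟩))
        rwa [dist_comm]
      rw [mollifier_apply, h0, Complex.ofReal_zero, mul_zero]
  rw [this, map_zero, map_zero]

/-- The regularization `F(θ u)` of a compactly supported distribution `φ f̂ = F u` is a test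
function whose support is close to the support of `φ`. -/
theorem exists_testFunction_regularize {φ : 𝓓(O, ℂ)} {f : ZDual O} {u : Rd d → ℂ}
    (hu : IsGivenBy (piece φ f) u) {p : ℝ≥0∞} (hp : 1 ≤ p) (hup : MemLp u p volume)
    (b : ContDiffBump (0 : Rd d)) (hb : Metric.cthickening b.rOut (tsupport φ) ⊆ O) :
    ∃ h : 𝓓(O, ℂ), (∀ ξ, h ξ = 𝓕 (fun x => multiplier b x * u x) ξ) ∧
      ∀ ξ ∉ Metric.cthickening b.rOut (tsupport φ), h ξ = 0 := by
  have hsub : tsupport (𝓕 fun x => multiplier b x * u x) ⊆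
      Metric.cthickening b.rOut (tsupport φ) :=
    closure_minimal (fun ξ hξ => by
      by_contra h
      exact hξ (fourier_multiplier_mul_eq_zero hu b h)) Metric.isClosed_cthickening
  have hc : IsCompact (Metric.cthickening b.rOut (tsupport φ)) :=
    IsCompact.cthickening (r := b.rOut) φ.hasCompactSupport
  exact ⟨⟨_, contDiff_fourier_schwartz_mul (multiplier b) hp hup,
    hc.of_isClosed_subset (isClosed_tsupport _) hsub, hsub.trans hb⟩, fun ξ => rfl,
    fun ξ hξ => fourier_multiplier_mul_eq_zero hu b hξ⟩

end Regularize

/-! ### Functions representing the pieces -/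

section GivenBy

variable {d : ℕ} {O : Opens (Rd d)}

theorem IsGivenBy.locallyIntegrable {T : 𝓢'(Rd d, ℂ)} {u : Rd d → ℂ} (hu : IsGivenBy T u) :
    LocallyIntegrable u := by
  rw [locallyIntegrable_iff]
  intro K hK
  obtain ⟨R, hR, hKR⟩ := hK.isBounded.subset_closedBall_lt 0 (0 : Rd d)
  let b : ContDiffBump (0 : Rd d) := ⟨R, R + 1, hR, by linarith⟩
  let g : 𝓢(Rd d, ℂ) := HasCompactSupport.toSchwartzMap (f := fun x => ((b x : ℝ) : ℂ))
    (b.hasCompactSupport.comp_left (g := fun t : ℝ => (t : ℂ)) Complex.ofReal_zero)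
    (Complex.ofRealCLM.contDiff.comp b.contDiff)
  refine ((hu g).1.integrableOn (s := K)).congr_fun (fun x hx => ?_) hK.measurableSet
  change u x * ((b x : ℝ) : ℂ) = u x
  rw [b.one_of_mem_closedBall (hKR hx), Complex.ofReal_one, mul_one]

theorem IsGivenBy.ae_eq {T : 𝓢'(Rd d, ℂ)} {u v : Rd d → ℂ} (hu : IsGivenBy T u)
    (hv : IsGivenBy T v) : u =ᵐ[volume] v := by
  refine ae_eq_of_integral_contDiff_smul_eq hu.locallyIntegrable hv.locallyIntegrable
    fun g hg hgs => ?_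
  let s : 𝓢(Rd d, ℂ) := HasCompactSupport.toSchwartzMap (f := fun x => ((g x : ℝ) : ℂ))
    (hgs.comp_left (g := fun t : ℝ => (t : ℂ)) Complex.ofReal_zero)
    (Complex.ofRealCLM.contDiff.comp hg)
  have h := (hu s).2.symm.trans (hv s).2
  have hs : ∀ w : Rd d → ℂ, ∫ x, g x • w x = ∫ x, w x * s x := fun w =>
    integral_congr_ae (Eventually.of_forall fun x => by
      change g x • w x = w x * ((g x : ℝ) : ℂ)
      rw [Complex.real_smul, mul_comm])
  rw [hs, hs, h]

/-- Representing functions agree almost everywhere, so the infimum in `lpNorm` runs over a single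
value. -/
theorem IsGivenBy.lpNorm_eq {T : 𝓢'(Rd d, ℂ)} {u : Rd d → ℂ} (hu : IsGivenBy T u) (p : ℝ≥0∞) :
    lpNorm p T = eLpNorm u p volume :=
  le_antisymm (iInf₂_le u hu) (le_iInf₂ fun _ hv => (eLpNorm_congr_ae (hu.ae_eq hv)).le)

theorem exists_isGivenBy_of_lpNorm_lt_top {T : 𝓢'(Rd d, ℂ)} {p : ℝ≥0∞} (h : lpNorm p T < ∞) :
    ∃ u : Rd d → ℂ, IsGivenBy T u ∧ MemLp u p volume := by
  obtain ⟨u, hu⟩ := iInf_lt_iff.1 h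
  obtain ⟨hu, hlt⟩ := iInf_lt_iff.1 hu
  exact ⟨u, hu, hu.locallyIntegrable.aestronglyMeasurable, hlt⟩

/-- The convolution kernel `F⁻¹ φ` of the Fourier multiplier `φ`. -/
noncomputable def kernel (φ : 𝓓(O, ℂ)) : 𝓢(Rd d, ℂ) := 𝓕⁻ (toSchwartz φ)

theorem kernel_coe (φ : 𝓓(O, ℂ)) : (kernel φ : Rd d → ℂ) = 𝓕⁻ (φ : Rd d → ℂ) :=
  SchwartzMap.fourierInv_coe _

theorem integrable_testFunction (φ : 𝓓(O, ℂ)) : Integrable (φ : Rd d → ℂ) :=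
  (toSchwartz φ).integrable

theorem fourier_mulTest_fourierInv (φ : 𝓓(O, ℂ)) (g : 𝓢(Rd d, ℂ)) (y : Rd d) :
    𝓕 (toSchwartz (mulTest φ (𝓕⁻ g))) y = ∫ x, kernel φ (x - y) * g x := by
  rw [SchwartzMap.fourier_coe, kernel_coe,
    ← fourier_mul_fourierInv (integrable_testFunction φ) g.integrable, ← SchwartzMap.fourierInv_coe]
  rfl

/-- The hypothesis says that `φ ê = φ F G` in the weak sense. As `F(φ F⁻¹ g)` is the correlation of
`F⁻¹ φ` with `g`, Fubini moves the kernel onto `G`. -/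
theorem isGivenBy_conv {φ : 𝓓(O, ℂ)} {e : ZDual O} {G : Rd d → ℂ} {p : ℝ≥0∞} (hp : 1 ≤ p)
    (hG : MemLp G p volume) (h : ∀ s : 𝓢(Rd d, ℂ), e (ZSpace.fourier O (mulTest φ s)) =
      ∫ y, G y * 𝓕 (toSchwartz (mulTest φ s)) y) :
    IsGivenBy (piece φ e) (conv (kernel φ) G) := by
  intro g
  refine ⟨?_, ?_⟩
  · refine (integrable_mul_of_memLp hp (fun q => g.memLp q volume)
      (memLp_conv (kernel φ) hp hG)).congr (Eventually.of_forall fun x => mul_comm _ _)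
  · rw [piece_apply, h, integral_conv_mul _ _ hp hG]
    simp_rw [fourier_mulTest_fourierInv]

theorem toZDual_fourierInv_apply (H h : 𝓓(O, ℂ)) :
    toZDual O (𝓕⁻ (toSchwartz H)) (ZSpace.fourier O h) = ∫ ξ, H ξ * h ξ := by
  change ∫ x, (𝓕⁻ (toSchwartz H) : 𝓢(Rd d, ℂ)) x * 𝓕 (toSchwartz h) x = _
  rw [SchwartzMap.integral_fourierInv_mul_eq, FourierTransform.fourierInv_fourier_eq]
  rfl

theorem isGivenBy_piece_toZDual (φ H : 𝓓(O, ℂ)) :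
    IsGivenBy (piece φ (toZDual O (𝓕⁻ (toSchwartz H))))
      (kernel (mulTest φ (toSchwartz H))) := by
  intro g
  refine ⟨integrable_mul_of_memLp le_top (fun q => (kernel _).memLp q volume)
    (g.memLp ∞ volume), ?_⟩
  rw [piece_apply, toZDual_fourierInv_apply, kernel, SchwartzMap.integral_fourierInv_mul_eq]
  refine integral_congr_ae (Eventually.of_forall fun ξ => ?_)
  change H ξ * (φ ξ * (𝓕⁻ g : 𝓢(Rd d, ℂ)) ξ) = φ ξ * H ξ * (𝓕⁻ g : 𝓢(Rd d, ℂ)) ξ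
  ring

end GivenBy

/-! ### Local finiteness of the partition of unity -/

section Partition

variable {d : ℕ} {O : Opens (Rd d)} {ι : Type*} {Q : ι → Set (Rd d)} {Φ : ι → 𝓓(O, ℂ)}

theorem sum_testFunction_apply (s : Finset ι) (h : ι → 𝓓(O, ℂ)) (ξ : Rd d) :
    (∑ i ∈ s, h i) ξ = ∑ i ∈ s, h i ξ := by
  classical
  induction s using Finset.induction_on with
  | empty => rfl
  | insert i s hi ih =>
    rw [Finset.sum_insert hi, Finset.sum_insert hi, ← ih]
    rfl

theorem IsBAPU.mem_of_ne_zero (hΦ : IsBAPU Q Φ) {i : ι} {ξ : Rd d} (h : Φ i ξ ≠ 0) : ξ ∈ Q i := by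
  by_contra hQ
  exact h (hΦ.eq_zero i ξ ⟨(Φ i).tsupport_subset (subset_tsupport _ h), hQ⟩)

theorem IsBAPU.exists_ne_zero (hΦ : IsBAPU Q Φ) {ξ : Rd d} (hξ : ξ ∈ O) : ∃ i, Φ i ξ ≠ 0 := by
  by_contra! h
  have h1 := hΦ.hasSum_one ξ hξ
  simp_rw [h] at h1
  exact zero_ne_one (hasSum_zero.unique h1)

theorem IsBAPU.mem_starSet (hΦ : IsBAPU Q Φ) {i k : ι} {ξ : Rd d} (hi : Φ i ξ ≠ 0)
    (hk : Φ k ξ ≠ 0) : i ∈ starSet Q k :=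
  ⟨ξ, hΦ.mem_of_ne_zero hi, hΦ.mem_of_ne_zero hk⟩

theorem isOpen_ne_zero (φ : 𝓓(O, ℂ)) : IsOpen {ξ | φ ξ ≠ 0} :=
  isOpen_ne_fun φ.continuous continuous_const

/-- The sets `Q k` need not be open, so the open sets `{φ_k ≠ 0}` stand in for them: one containing
a limit point of `{φ_i ≠ 0}` meets that set, which puts `k` in `i^*`. -/
theorem IsBAPU.tsupport_subset_iUnion (hΦ : IsBAPU Q Φ) (i : ι) :
    tsupport (Φ i) ⊆ ⋃ k ∈ starSet Q i, {ξ | Φ k ξ ≠ 0} := by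
  intro ξ hξ
  obtain ⟨k, hk⟩ := hΦ.exists_ne_zero ((Φ i).tsupport_subset hξ)
  obtain ⟨η, hηk, hηi⟩ := mem_closure_iff.1 hξ _ (isOpen_ne_zero (Φ k)) hk
  exact mem_biUnion (hΦ.mem_starSet hηk hηi) hk

/-- Finitely many sets `{φ_k ≠ 0}` cover `K`, and a `φ_i` that is nonzero at a point of one of them
has `i ∈ k^*`, a finite set. -/
theorem IsBAPU.finite_ne_zero_on (hΦ : IsBAPU Q Φ) (hQ : ∀ i, (starSet Q i).Finite)
    {K : Set (Rd d)} (hK : IsCompact K) (hKO : K ⊆ O) : {i | ∃ ξ ∈ K, Φ i ξ ≠ 0}.Finite := by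
  obtain ⟨t, ht⟩ := hK.elim_finite_subcover (fun i => {ξ | Φ i ξ ≠ 0})
    (fun i => isOpen_ne_zero (Φ i)) fun ξ hξ => mem_iUnion.2 (hΦ.exists_ne_zero (hKO hξ))
  refine (t.finite_toSet.biUnion fun k _ => hQ k).subset ?_
  rintro i ⟨ξ, hξK, hξ⟩
  obtain ⟨k, hkt, hk⟩ := mem_iUnion₂.1 (ht hξK)
  exact mem_biUnion hkt (hΦ.mem_starSet hξ hk)

/-- Each `Q i` meets some `{φ_k ≠ 0}`, and this open set contains a point of a countable dense set.
Over each such point there are finitely many `k`, each with finite `k^*`. -/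
theorem countable_index (hcov : IsAdmissibleCover O Q) (hΦ : IsBAPU Q Φ) : Countable ι := by
  have hQ := finite_starSet hcov.card_star
  obtain ⟨s, hs, hsd⟩ := TopologicalSpace.exists_countable_dense (Rd d)
  have h1 : (⋃ ξ ∈ s ∩ (O : Set (Rd d)), ⋃ k ∈ {k | Φ k ξ ≠ 0}, starSet Q k).Countable := by
    refine (hs.mono inter_subset_left).biUnion fun ξ hξ => ?_
    refine Set.Finite.countable (Set.Finite.biUnion ?_ fun k _ => hQ k)
    have h2 := hΦ.finite_ne_zero_on hQ (isCompact_singleton (x := ξ)) (by simpa using hξ.2)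
    simpa using h2
  rw [← Set.countable_univ_iff]
  refine h1.mono fun i _ => ?_
  obtain ⟨η, hη⟩ := hcov.nonempty i
  obtain ⟨k, hk⟩ := hΦ.exists_ne_zero
    (show η ∈ (O : Set (Rd d)) from hcov.iUnion_eq ▸ mem_iUnion_of_mem i hη)
  obtain ⟨ξ, hξ, hξs⟩ := hsd.exists_mem_open (isOpen_ne_zero (Φ k)) ⟨η, hk⟩
  refine mem_biUnion (x := ξ) ⟨hξ, (Φ k).tsupport_subset (subset_tsupport _ hξs)⟩ ?_
  exact mem_biUnion (x := k) hξs ⟨η, hη, hΦ.mem_of_ne_zero hk⟩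

theorem IsBAPU.sum_star₂ (hΦ : IsBAPU Q Φ) (hQ : ∀ i, (starSet Q i).Finite) {j : ι} {ξ : Rd d}
    (hj : Φ j ξ ≠ 0) : ∑ i ∈ star₂ hQ j, Φ i ξ = 1 := by
  refine (hasSum_sum_of_ne_finset_zero fun i hi => ?_).unique
    (hΦ.hasSum_one ξ ((Φ j).tsupport_subset (subset_tsupport _ hj)))
  by_contra h
  exact hi ((mem_star₂ hQ).2 ⟨i, hΦ.mem_starSet h hj, hΦ.mem_starSet h h⟩)

theorem IsBAPU.sum_mulTest_mulTest (hΦ : IsBAPU Q Φ) (hQ : ∀ i, (starSet Q i).Finite) (j : ι)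
    (s : 𝓢(Rd d, ℂ)) :
    ∑ i ∈ star₂ hQ j, mulTest (Φ i) (toSchwartz (mulTest (Φ j) s)) = mulTest (Φ j) s := by
  ext ξ
  rw [sum_testFunction_apply]
  change ∑ i ∈ star₂ hQ j, Φ i ξ * (Φ j ξ * s ξ) = Φ j ξ * s ξ
  rw [← Finset.sum_mul]
  by_cases hj : Φ j ξ = 0
  · simp [hj]
  · rw [hΦ.sum_star₂ hQ hj, one_mul]

theorem IsBAPU.exists_sum_mulTest_eq (hΦ : IsBAPU Q Φ) (hQ : ∀ i, (starSet Q i).Finite)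
    (h : 𝓓(O, ℂ)) : ∃ M : Finset ι, ∑ j ∈ M, mulTest (Φ j) (toSchwartz h) = h := by
  have hfin := hΦ.finite_ne_zero_on hQ h.hasCompactSupport h.tsupport_subset
  refine ⟨hfin.toFinset, ?_⟩
  ext ξ
  rw [sum_testFunction_apply]
  change ∑ j ∈ hfin.toFinset, Φ j ξ * h ξ = h ξ
  by_cases hξ : h ξ = 0
  · simp [hξ]
  · have hξt := subset_tsupport h hξ
    rw [← Finset.sum_mul, (hasSum_sum_of_ne_finset_zero fun i hi => ?_).unique
      (hΦ.hasSum_one ξ (h.tsupport_subset hξt)), one_mul]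
    by_contra h0
    exact hi (by simpa using ⟨ξ, hξt, h0⟩)

end Partition

/-! ### Construction of the approximating test functions -/

section Approximation

variable {d : ℕ} {O : Opens (Rd d)} {ι : Type*} {Q : ι → Set (Rd d)} {Φ : ι → 𝓓(O, ℂ)}

/-- The factor `θ` if `i ∈ J`, and `0` otherwise. -/
noncomputable def cutoff (J : Finset ι) (b : ContDiffBump (0 : Rd d)) (i : ι) (x : Rd d) : ℂ :=
  open Classical in if i ∈ J then multiplier b x else 0

/-- The function `∑_{i ∈ j^{**} ∩ J} θ u_i`. -/
noncomputable def damped (hQ : ∀ i, (starSet Q i).Finite) (u : ι → Rd d → ℂ) (J : Finset ι)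
    (b : ContDiffBump (0 : Rd d)) (j : ι) (x : Rd d) : ℂ :=
  ∑ i ∈ star₂ hQ j, cutoff J b i x * u i x

theorem norm_cutoff_le (J : Finset ι) (b : ContDiffBump (0 : Rd d)) (i : ι) (x : Rd d) :
    ‖cutoff J b i x‖ ≤ 1 := by
  unfold cutoff
  split_ifs
  · exact norm_multiplier_le b x
  · simp

theorem continuous_cutoff (J : Finset ι) (b : ContDiffBump (0 : Rd d)) (i : ι) :
    Continuous (cutoff J b i) := by
  unfold cutoff
  split_ifs
  · exact (multiplier b).continuous
  · exact continuous_const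

theorem tendsto_cutoff {J : ℕ → Finset ι} (hJ : ∀ i, ∀ᶠ n in atTop, i ∈ J n)
    {b : ℕ → ContDiffBump (0 : Rd d)} (hb : Tendsto (fun n => (b n).rOut) atTop (𝓝 0)) (i : ι)
    (x : Rd d) : Tendsto (fun n => cutoff (J n) (b n) i x) atTop (𝓝 1) := by
  refine (tendsto_multiplier hb x).congr' ?_
  filter_upwards [hJ i] with n hn
  exact (if_pos hn).symm

theorem integrable_cutoff_mul {p : ℝ≥0∞} (hp : 1 ≤ p) {v : Rd d → ℂ} (hv : MemLp v p volume)
    (J : Finset ι) (b : ContDiffBump (0 : Rd d)) (i : ι) :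
    Integrable fun x => cutoff J b i x * v x := by
  unfold cutoff
  split_ifs
  · exact integrable_multiplier_mul b hp hv
  · simp

theorem memLp_cutoff_mul {p : ℝ≥0∞} {v : Rd d → ℂ} (hv : MemLp v p volume)
    (J : Finset ι) (b : ContDiffBump (0 : Rd d)) (i : ι) :
    MemLp (fun x => cutoff J b i x * v x) p volume := by
  refine hv.mono ((continuous_cutoff J b i).aestronglyMeasurable.mul hv.1)
    (Eventually.of_forall fun x => ?_)
  rw [norm_mul]
  exact mul_le_of_le_one_left (norm_nonneg _) (norm_cutoff_le J b i x)

theorem integrable_damped (hQ : ∀ i, (starSet Q i).Finite) {u : ι → Rd d → ℂ} {p : ℝ≥0∞}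
    (hp : 1 ≤ p) (hup : ∀ i, MemLp (u i) p volume) (J : Finset ι) (b : ContDiffBump (0 : Rd d))
    (j : ι) : Integrable (damped hQ u J b j) :=
  integrable_finsetSum _ fun i _ => integrable_cutoff_mul hp (hup i) J b i

theorem memLp_damped (hQ : ∀ i, (starSet Q i).Finite) {u : ι → Rd d → ℂ} {p : ℝ≥0∞}
    (hup : ∀ i, MemLp (u i) p volume) (J : Finset ι) (b : ContDiffBump (0 : Rd d))
    (j : ι) : MemLp (damped hQ u J b j) p volume :=
  memLp_finsetSum _ fun i _ => memLp_cutoff_mul (hup i) J b i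

theorem norm_damped_le (hQ : ∀ i, (starSet Q i).Finite) (u : ι → Rd d → ℂ) (J : Finset ι)
    (b : ContDiffBump (0 : Rd d)) (j : ι) (x : Rd d) :
    ‖damped hQ u J b j x‖ ≤ ∑ i ∈ star₂ hQ j, ‖u i x‖ := by
  refine norm_sum_le_of_le _ fun i _ => ?_
  rw [norm_mul]
  exact mul_le_of_le_one_left (norm_nonneg _) (norm_cutoff_le J b i x)

theorem fourier_damped (hQ : ∀ i, (starSet Q i).Finite) {u : ι → Rd d → ℂ} {p : ℝ≥0∞}
    (hp : 1 ≤ p) (hup : ∀ i, MemLp (u i) p volume) (J : Finset ι) (b : ContDiffBump (0 : Rd d))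
    (j : ι) (ξ : Rd d) :
    𝓕 (damped hQ u J b j) ξ = ∑ i ∈ star₂ hQ j, 𝓕 (fun x => cutoff J b i x * u i x) ξ := by
  simp only [Real.fourier_eq, Circle.smul_def, smul_eq_mul, damped, Finset.mul_sum]
  refine integral_finsetSum _ fun i _ => ?_
  exact integrable_fourierChar_mul (integrable_cutoff_mul hp (hup i) J b i)
    (a := fun x => -inner ℝ x ξ) (by fun_prop)

theorem IsBAPU.exists_cthickening_subset (hΦ : IsBAPU Q Φ) (J : Finset ι) :
    ∃ δ : ℝ, 0 < δ ∧ ∀ i ∈ J,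
      Metric.cthickening δ (tsupport (Φ i)) ⊆ ⋃ k ∈ starSet Q i, {ξ | Φ k ξ ≠ 0} := by
  have h : ∀ i ∈ J, ∀ᶠ δ in 𝓝[>] (0 : ℝ),
      Metric.cthickening δ (tsupport (Φ i)) ⊆ ⋃ k ∈ starSet Q i, {ξ | Φ k ξ ≠ 0} := by
    intro i _
    obtain ⟨δ, hδ, hsub⟩ := IsCompact.exists_cthickening_subset_open
      (Φ i).hasCompactSupport (isOpen_biUnion fun k _ => isOpen_ne_zero (Φ k))
      (hΦ.tsupport_subset_iUnion i)
    filter_upwards [Ioo_mem_nhdsGT hδ] with ε hε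
    exact (Metric.cthickening_mono hε.2.le _).trans hsub
  obtain ⟨δ, hδ, hδ0⟩ :=
    (((Filter.eventually_all_finset J).2 h).and self_mem_nhdsWithin).exists
  exact ⟨δ, hδ0, hδ⟩

/-- Localization of `H = ∑_{i ∈ J} F(θ u_i)`. Where the `i`-th term and `φ_j` are both nonzero, some
`φ_k` with `k ∈ i^*` is nonzero too; then `k ∈ j^*`, so `i ∈ j^{**}`. Enlarging the support is what
forces second-order neighbours. -/
theorem IsBAPU.exists_regularization (hΦ : IsBAPU Q Φ) (hQ : ∀ i, (starSet Q i).Finite)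
    {f : ZDual O} {u : ι → Rd d → ℂ} (hu : ∀ i, IsGivenBy (piece (Φ i) f) (u i)) {p : ℝ≥0∞}
    (hp : 1 ≤ p) (hup : ∀ i, MemLp (u i) p volume) (J : Finset ι) :
    ∃ δ : ℝ, 0 < δ ∧ ∀ b : ContDiffBump (0 : Rd d), b.rOut ≤ δ → ∃ H : 𝓓(O, ℂ), ∀ j ξ,
      Φ j ξ * H ξ = Φ j ξ * 𝓕 (damped hQ u J b j) ξ := by
  classical
  obtain ⟨δ, hδ, hsub⟩ := hΦ.exists_cthickening_subset J
  refine ⟨δ, hδ, fun b hb => ?_⟩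
  have hsub' : ∀ i ∈ J, Metric.cthickening b.rOut (tsupport (Φ i)) ⊆
      ⋃ k ∈ starSet Q i, {ξ | Φ k ξ ≠ 0} :=
    fun i hi => (Metric.cthickening_mono hb _).trans (hsub i hi)
  have hex : ∀ i, ∃ h : 𝓓(O, ℂ), i ∈ J →
      (∀ ξ, h ξ = 𝓕 (fun x => multiplier b x * u i x) ξ) ∧
      ∀ ξ ∉ Metric.cthickening b.rOut (tsupport (Φ i)), h ξ = 0 := by
    intro i
    by_cases hi : i ∈ J
    · obtain ⟨h, hh⟩ := exists_testFunction_regularize (hu i) hp (hup i) b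
        ((hsub' i hi).trans (iUnion₂_subset fun k _ ξ hξ =>
          (Φ k).tsupport_subset (subset_tsupport _ hξ)))
      exact ⟨h, fun _ => hh⟩
    · exact ⟨0, fun h => absurd h hi⟩
  choose h hh using hex
  refine ⟨∑ i ∈ J, h i, fun j ξ => ?_⟩
  by_cases hj : Φ j ξ = 0
  · simp [hj]
  rw [sum_testFunction_apply, fourier_damped hQ hp hup]
  congr 1
  have h1 : ∀ i ∈ J, h i ξ ≠ 0 → i ∈ star₂ hQ j := by
    intro i hi hne
    have hmem : ξ ∈ Metric.cthickening b.rOut (tsupport (Φ i)) := by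
      by_contra hξ
      exact hne ((hh i hi).2 ξ hξ)
    obtain ⟨k, hk, hkξ⟩ := mem_iUnion₂.1 (hsub' i hi hmem)
    exact (mem_star₂ hQ).2 ⟨k, hΦ.mem_starSet hkξ hj, mem_starSet_comm.1 hk⟩
  have h2 : ∀ i, 𝓕 (fun x => cutoff J b i x * u i x) ξ = if i ∈ J then h i ξ else 0 := by
    intro i
    by_cases hi : i ∈ J
    · rw [if_pos hi, (hh i hi).1]
      simp only [cutoff, if_pos hi]
    · rw [if_neg hi]
      simp [cutoff, if_neg hi, Real.fourier_eq]
  simp_rw [h2]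
  rw [Finset.sum_ite_mem, Finset.inter_comm]
  refine (Finset.sum_subset Finset.inter_subset_left fun i hi hni => ?_).symm
  by_contra hne
  exact hni (Finset.mem_inter.2 ⟨hi, h1 i hi hne⟩)

theorem exists_finset_seq [Countable ι] :
    ∃ J : ℕ → Finset ι, ∀ i, ∀ᶠ n in atTop, i ∈ J n := by
  obtain ⟨J, hJ⟩ := Filter.exists_seq_tendsto (atTop : Filter (Finset ι))
  refine ⟨J, fun i => ?_⟩
  filter_upwards [hJ.eventually (eventually_ge_atTop {i})] with n hn
  exact hn (Finset.mem_singleton_self i)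

theorem IsBAPU.exists_approximating_sequence [Countable ι] (hΦ : IsBAPU Q Φ)
    (hQ : ∀ i, (starSet Q i).Finite) {f : ZDual O} {u : ι → Rd d → ℂ}
    (hu : ∀ i, IsGivenBy (piece (Φ i) f) (u i)) {p : ℝ≥0∞} (hp : 1 ≤ p)
    (hup : ∀ i, MemLp (u i) p volume) :
    ∃ (J : ℕ → Finset ι) (b : ℕ → ContDiffBump (0 : Rd d)) (H : ℕ → 𝓓(O, ℂ)),
      (∀ i, ∀ᶠ n in atTop, i ∈ J n) ∧ Tendsto (fun n => (b n).rOut) atTop (𝓝 0) ∧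
      ∀ n j ξ, Φ j ξ * H n ξ = Φ j ξ * 𝓕 (damped hQ u (J n) (b n) j) ξ := by
  obtain ⟨J, hJ⟩ := exists_finset_seq (ι := ι)
  choose δ hδ hreg using fun n => hΦ.exists_regularization hQ hu hp hup (J n)
  -- The outer radius must respect the support condition for `J n` and also tend to zero; the inner
  -- radius only has to be smaller.
  have hr : ∀ n : ℕ, 0 < min (δ n) (1 / ((n : ℝ) + 1)) := fun n => lt_min (hδ n) (by positivity)
  let b : ℕ → ContDiffBump (0 : Rd d) := fun n =>
    ⟨min (δ n) (1 / ((n : ℝ) + 1)) / 2, min (δ n) (1 / ((n : ℝ) + 1)), half_pos (hr n),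
      half_lt_self (hr n)⟩
  choose H hH using fun n => hreg n (b n) (min_le_left _ _)
  refine ⟨J, b, H, hJ, ?_, hH⟩
  exact squeeze_zero (fun n => (hr n).le) (fun n => min_le_right _ _)
    tendsto_one_div_add_atTop_nhds_zero_nat

/-- The counterpart for `f` itself: `φ_j f̂ = φ_j F(∑_{i ∈ j^{**}} u_i)`. Comparing it with the
identity for `H n` reduces both limits to `θ → 1`. -/
theorem IsBAPU.apply_fourier_mulTest (hΦ : IsBAPU Q Φ) (hQ : ∀ i, (starSet Q i).Finite)
    {f : ZDual O} {u : ι → Rd d → ℂ} (hu : ∀ i, IsGivenBy (piece (Φ i) f) (u i)) (j : ι)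
    (s : 𝓢(Rd d, ℂ)) :
    f (ZSpace.fourier O (mulTest (Φ j) s)) =
      ∫ y, (∑ i ∈ star₂ hQ j, u i y) * 𝓕 (toSchwartz (mulTest (Φ j) s)) y := by
  have h1 : ∀ i, f (ZSpace.fourier O (mulTest (Φ i) (toSchwartz (mulTest (Φ j) s)))) =
      ∫ y, u i y * 𝓕 (toSchwartz (mulTest (Φ j) s)) y := fun i => by
    rw [← (hu i _).2, piece_apply, FourierTransform.fourierInv_fourier_eq]
  conv_lhs => rw [← hΦ.sum_mulTest_mulTest hQ j s]
  rw [map_sum, map_sum]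
  simp_rw [h1, Finset.sum_mul]
  exact (integral_finsetSum _ fun i _ => (hu i _).1).symm

theorem toZDual_apply_fourier_mulTest {φ H : 𝓓(O, ℂ)} {G : Rd d → ℂ} (hG : Integrable G)
    (h : ∀ ξ, φ ξ * H ξ = φ ξ * 𝓕 G ξ) (s : 𝓢(Rd d, ℂ)) :
    toZDual O (𝓕⁻ (toSchwartz H)) (ZSpace.fourier O (mulTest φ s)) =
      ∫ y, G y * 𝓕 (toSchwartz (mulTest φ s)) y := by
  rw [toZDual_fourierInv_apply, SchwartzMap.fourier_coe,
    ← integral_fourier_mul_of_integrable hG (toSchwartz (mulTest φ s)).integrable]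
  refine integral_congr_ae (Eventually.of_forall fun ξ => ?_)
  change H ξ * (φ ξ * s ξ) = 𝓕 G ξ * (φ ξ * s ξ)
  rw [← mul_assoc, ← mul_assoc, mul_comm (H ξ), h, mul_comm (φ ξ)]

theorem kernel_mulTest_eq_conv {φ H : 𝓓(O, ℂ)} {G : Rd d → ℂ} (hG : Integrable G)
    (h : ∀ ξ, φ ξ * H ξ = φ ξ * 𝓕 G ξ) (x : Rd d) :
    kernel (mulTest φ (toSchwartz H)) x = conv (kernel φ) G x := by
  rw [kernel_coe, conv, kernel_coe, ← fourierInv_mul_fourier (integrable_testFunction φ) hG]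
  exact congrArg (fun v : Rd d → ℂ => 𝓕⁻ v x) (funext h)

end Approximation

/-! ### Norm estimates, domination and the two limits -/

section Main

variable {d : ℕ} {O : Opens (Rd d)} {ι : Type*} {Q : ι → Set (Rd d)} {Φ : ι → 𝓓(O, ℂ)}

theorem decompNorm_toZDual_lt_top (hΦ : IsBAPU Q Φ) (hQ : ∀ i, (starSet Q i).Finite) (w : ι → ℝ)
    (p : ℝ≥0∞) {q : ℝ≥0∞} (hq : 1 ≤ q) (h : 𝓓(O, ℂ)) :
    decompNorm Φ w p q (toZDual O (𝓕⁻ (toSchwartz h))) < ∞ := by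
  have hlp : ∀ i, lpNorm p (piece (Φ i) (toZDual O (𝓕⁻ (toSchwartz h)))) =
      eLpNorm (kernel (mulTest (Φ i) (toSchwartz h))) p volume :=
    fun i => (isGivenBy_piece_toZDual (Φ i) h).lpNorm_eq p
  unfold decompNorm
  simp_rw [hlp]
  refine wlNorm_lt_top_of_finite w hq ?_ fun i => (SchwartzMap.memLp _ p volume).2
  refine (hΦ.finite_ne_zero_on hQ h.hasCompactSupport h.tsupport_subset).subset fun i hi => ?_
  by_contra hne
  refine hi ?_
  have h0 : ∀ ξ, Φ i ξ * h ξ = 0 := fun ξ => by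
    by_cases hξ : h ξ = 0
    · rw [hξ, mul_zero]
    · have : Φ i ξ = 0 := by
        by_contra h1
        exact hne ⟨ξ, subset_tsupport _ hξ, h1⟩
      rw [this, zero_mul]
  have hk : (kernel (mulTest (Φ i) (toSchwartz h)) : Rd d → ℂ) = 0 := by
    have h1 : ((mulTest (Φ i) (toSchwartz h) : 𝓓(O, ℂ)) : Rd d → ℂ) = fun _ => 0 := funext h0
    rw [kernel_coe, h1]
    funext x
    simp [Real.fourierInv_eq]
  rw [hk, eLpNorm_zero]

theorem exists_isGivenBy_of_decompNorm_lt_top {w : ι → ℝ} (hw : ∀ i, 0 < w i) {p q : ℝ≥0∞}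
    (hq : 1 ≤ q) {f : ZDual O} (hf : decompNorm Φ w p q f < ∞) :
    ∃ u : ι → Rd d → ℂ, (∀ i, IsGivenBy (piece (Φ i) f) (u i)) ∧ ∀ i, MemLp (u i) p volume := by
  have h := fun i => exists_isGivenBy_of_lpNorm_lt_top (lt_top_of_wlNorm_lt_top hw hq hf i)
  choose u hu using h
  exact ⟨u, fun i => (hu i).1, fun i => (hu i).2⟩

/-- The dominating family `F_j = |F⁻¹ φ_j| * ∑_{i ∈ j^{**}} |u_i|`. -/
noncomputable def majorant (hQ : ∀ i, (starSet Q i).Finite) (Φ : ι → 𝓓(O, ℂ))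
    (u : ι → Rd d → ℂ) (j : ι) : Rd d → ℝ :=
  absConv (kernel (Φ j)) fun y => ∑ i ∈ star₂ hQ j, ‖u i y‖

theorem memLp_sum_norm {u : ι → Rd d → ℂ} {p : ℝ≥0∞} (hup : ∀ i, MemLp (u i) p volume)
    (s : Finset ι) : MemLp (fun y => ∑ i ∈ s, ‖u i y‖) p volume :=
  memLp_finsetSum _ fun i _ => (hup i).norm

theorem eLpNorm_kernel_le (Φ : ι → 𝓓(O, ℂ)) (j : ι) :
    eLpNorm (kernel (Φ j)) 1 volume ≤ bapuConst Φ :=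
  le_iSup (fun i => eLpNorm (𝓕⁻ (toSchwartz (Φ i)) : 𝓢(Rd d, ℂ)) 1 volume) j

theorem eLpNorm_majorant_le (hQ : ∀ i, (starSet Q i).Finite) {u : ι → Rd d → ℂ} {p : ℝ≥0∞}
    (hp : 1 ≤ p) (hup : ∀ i, MemLp (u i) p volume) (j : ι) :
    eLpNorm (majorant hQ Φ u j) p volume ≤
      bapuConst Φ * ∑ i ∈ star₂ hQ j, eLpNorm (u i) p volume := by
  refine (eLpNorm_le_of_enorm_le_conv (kernel (Φ j)).continuous
    (memLp_sum_norm hup _).1 hp (enorm_absConv_le _ _)).trans ?_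
  refine mul_le_mul' (eLpNorm_kernel_le Φ j) ?_
  have h := eLpNorm_sum_le (μ := volume) (f := fun i y => ‖u i y‖) (s := star₂ hQ j)
    (fun i _ => (hup i).norm.1) hp
  simp only [eLpNorm_norm] at h
  refine le_trans (le_of_eq ?_) h
  congr 1
  funext y
  simp

theorem mixedNorm_majorant_le (hQ : ∀ i, (starSet Q i).Finite) {w : ι → ℝ} (hw : ∀ i, 0 < w i)
    {p q : ℝ≥0∞} (hp : 1 ≤ p) (hq : 1 ≤ q) (hfin : clusteringNorm Q w q < ∞) {f : ZDual O}
    (hf : decompNorm Φ w p q f < ∞) {u : ι → Rd d → ℂ}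
    (hu : ∀ i, IsGivenBy (piece (Φ i) f) (u i)) (hup : ∀ i, MemLp (u i) p volume) :
    mixedNorm w p q (majorant hQ Φ u) ≤
      bapuConst Φ * clusteringNorm Q w q ^ 2 * decompNorm Φ w p q f := by
  have hlp : (fun i => lpNorm p (piece (Φ i) f)) = fun i => eLpNorm (u i) p volume :=
    funext fun i => (hu i).lpNorm_eq p
  unfold decompNorm at hf ⊢
  rw [hlp] at hf ⊢
  refine (wlNorm_mono w q fun j => eLpNorm_majorant_le hQ hp hup j).trans ?_
  rw [wlNorm_const_mul w hq, mul_assoc]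
  exact mul_le_mul_right (wlNorm_sum_star₂_le hQ hw hq hfin hf) _

theorem isDominated_toZDual (hQ : ∀ i, (starSet Q i).Finite) {u : ι → Rd d → ℂ} {p : ℝ≥0∞}
    (hp : 1 ≤ p) (hup : ∀ i, MemLp (u i) p volume) {J : Finset ι} {b : ContDiffBump (0 : Rd d)}
    {H : 𝓓(O, ℂ)} (hH : ∀ j ξ, Φ j ξ * H ξ = Φ j ξ * 𝓕 (damped hQ u J b j) ξ) :
    IsDominated (majorant hQ Φ u) Φ (toZDual O (𝓕⁻ (toSchwartz H))) := by
  intro j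
  refine ⟨_, SchwartzMap.smooth _ ⊤, isGivenBy_piece_toZDual (Φ j) H, fun x => ?_⟩
  rw [kernel_mulTest_eq_conv (integrable_damped hQ hp hup J b j) (hH j)]
  exact norm_conv_le_absConv _ hp (memLp_sum_norm hup _) (norm_damped_le hQ u J b j) x

theorem tendstoZDual_of_approximating (hΦ : IsBAPU Q Φ) (hQ : ∀ i, (starSet Q i).Finite)
    {f : ZDual O} {u : ι → Rd d → ℂ} (hu : ∀ i, IsGivenBy (piece (Φ i) f) (u i)) {p : ℝ≥0∞}
    (hp : 1 ≤ p) (hup : ∀ i, MemLp (u i) p volume) {J : ℕ → Finset ι}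
    {b : ℕ → ContDiffBump (0 : Rd d)} {H : ℕ → 𝓓(O, ℂ)} (hJ : ∀ i, ∀ᶠ n in atTop, i ∈ J n)
    (hb : Tendsto (fun n => (b n).rOut) atTop (𝓝 0))
    (hH : ∀ n j ξ, Φ j ξ * H n ξ = Φ j ξ * 𝓕 (damped hQ u (J n) (b n) j) ξ) :
    TendstoZDual (fun n => toZDual O (𝓕⁻ (toSchwartz (H n)))) f := by
  intro ψ
  obtain ⟨h, rfl⟩ := (ZSpace.fourier_bijective O).2 ψ
  -- A test function is a finite sum of localized ones `φ_j h`, so the limit can be taken for each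
  -- `j` separately.
  obtain ⟨M, hM⟩ := hΦ.exists_sum_mulTest_eq hQ h
  rw [← hM]
  simp only [map_sum]
  refine tendsto_finsetSum _ fun j _ => ?_
  rw [hΦ.apply_fourier_mulTest hQ hu]
  simp_rw [fun n => toZDual_apply_fourier_mulTest
    (integrable_damped hQ hp hup (J n) (b n) j) (hH n j)]
  set s : 𝓢(Rd d, ℂ) := 𝓕 (toSchwartz (mulTest (Φ j) (toSchwartz h)))
  -- The factor `s` is Schwartz, so the majorant is integrable even for `p = ∞`.
  refine tendsto_integral_of_dominated_convergence
    (fun y => (∑ i ∈ star₂ hQ j, ‖u i y‖) * ‖s y‖)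
    (fun n => (integrable_damped hQ hp hup (J n) (b n) j).1.mul s.continuous.aestronglyMeasurable)
    ?_ (fun n => Eventually.of_forall fun y => ?_) (Eventually.of_forall fun y => ?_)
  · simp_rw [Finset.sum_mul]
    refine integrable_finsetSum _ fun i _ => ?_
    refine (integrable_mul_of_memLp hp (fun q => s.memLp q volume) (hup i)).norm.congr
      (Eventually.of_forall fun y => ?_)
    simp only [norm_mul, mul_comm]
  · rw [norm_mul]
    exact mul_le_mul_of_nonneg_right (norm_damped_le hQ u _ _ j y) (norm_nonneg _)
  · refine Tendsto.mul_const (s y) (tendsto_finsetSum _ fun i _ => ?_)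
    simpa using (tendsto_cutoff hJ hb i y).mul_const (u i y)

theorem tendsto_eLpNorm_one_sub_mul {c : ℕ → Rd d → ℂ} (hc : ∀ n, Continuous (c n))
    (hc1 : ∀ n x, ‖c n x‖ ≤ 1) (hlim : ∀ x, Tendsto (fun n => c n x) atTop (𝓝 1))
    {v : Rd d → ℂ} {p : ℝ≥0∞} (hp : 1 ≤ p) (hpt : p < ∞) (hv : MemLp v p volume) :
    Tendsto (fun n => eLpNorm (fun x => (1 - c n x) * v x) p volume) atTop (𝓝 0) := by
  have hp0 : p ≠ 0 := (zero_lt_one.trans_le hp).ne'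
  have hr0 : 0 < p.toReal := ENNReal.toReal_pos hp0 hpt.ne
  simp_rw [eLpNorm_eq_lintegral_rpow_enorm_toReal hp0 hpt.ne]
  have hmain : Tendsto (fun n => ∫⁻ x, ‖(1 - c n x) * v x‖ₑ ^ p.toReal) atTop (𝓝 0) := by
    rw [← lintegral_zero (μ := (volume : Measure (Rd d)))]
    refine tendsto_lintegral_of_dominated_convergence' (fun x => (2 * ‖v x‖ₑ) ^ p.toReal)
      (fun n => ?_) (fun n => Eventually.of_forall fun x => ?_) ?_
      (Eventually.of_forall fun x => ?_)
    · exact ((continuous_const.sub (hc n)).aestronglyMeasurable.mul hv.1).enorm.pow_const _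
    · refine ENNReal.rpow_le_rpow ?_ hr0.le
      rw [enorm_mul]
      refine mul_le_mul_left ?_ _
      have h2 : ‖1 - c n x‖ ≤ 2 := by
        refine (norm_sub_le _ _).trans ?_
        rw [norm_one]
        linarith [hc1 n x]
      rw [← ofReal_norm]
      exact ENNReal.ofReal_le_of_le_toReal (by simpa using h2)
    · simp_rw [ENNReal.mul_rpow_of_nonneg _ _ hr0.le]
      rw [lintegral_const_mul'' _ (hv.1.enorm.pow_const _)]
      exact ENNReal.mul_ne_top (ENNReal.rpow_ne_top_of_nonneg hr0.le (by simp))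
        (lintegral_rpow_enorm_lt_top_of_eLpNorm_lt_top hp0 hpt.ne hv.2).ne
    · have h1 : Tendsto (fun n => (1 - c n x) * v x) atTop (𝓝 0) := by
        simpa using ((hlim x).const_sub 1).mul_const (v x)
      have h2 := h1.enorm.ennrpow_const p.toReal
      simpa [hr0] using h2
  have h3 := hmain.ennrpow_const (1 / p.toReal)
  simpa [hr0] using h3

/-- The pieces of the error are `k_j * ∑_{i ∈ j^{**}} (1 - θ_i) u_i`, with `θ_i = θ` on `J n` and
`0` off it. Each tends to zero in `L^p`, and a fixed `ℓ^q_w` family dominates their norms. -/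
theorem tendsto_decompNorm_sub (hΦ : IsBAPU Q Φ) (hQ : ∀ i, (starSet Q i).Finite) {w : ι → ℝ}
    (hw : ∀ i, 0 < w i) {p q : ℝ≥0∞} (hp : 1 ≤ p) (hq : 1 ≤ q) (hpt : p < ∞) (hqt : q < ∞)
    (hfin : clusteringNorm Q w q < ∞) {f : ZDual O} (hf : decompNorm Φ w p q f < ∞)
    {u : ι → Rd d → ℂ} (hu : ∀ i, IsGivenBy (piece (Φ i) f) (u i))
    (hup : ∀ i, MemLp (u i) p volume) {J : ℕ → Finset ι}
    {b : ℕ → ContDiffBump (0 : Rd d)} {H : ℕ → 𝓓(O, ℂ)} (hJ : ∀ i, ∀ᶠ n in atTop, i ∈ J n)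
    (hb : Tendsto (fun n => (b n).rOut) atTop (𝓝 0))
    (hH : ∀ n j ξ, Φ j ξ * H n ξ = Φ j ξ * 𝓕 (damped hQ u (J n) (b n) j) ξ) :
    Tendsto (fun n => decompNorm Φ w p q (f - toZDual O (𝓕⁻ (toSchwartz (H n))))) atTop
      (𝓝 0) := by
  let G : ℕ → ι → Rd d → ℂ := fun n j y =>
    ∑ i ∈ star₂ hQ j, (1 - cutoff (J n) (b n) i y) * u i y
  have hGterm : ∀ n i, MemLp (fun y => (1 - cutoff (J n) (b n) i y) * u i y) p volume :=
    fun n i => ((hup i).sub (memLp_cutoff_mul (hup i) (J n) (b n) i)).ae_eq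
      (Eventually.of_forall fun y => by simp [sub_mul])
  have hG : ∀ n j, MemLp (G n j) p volume := fun n j => memLp_finsetSum _ fun i _ => hGterm n i
  have hGeq : ∀ n j y, G n j y = (∑ i ∈ star₂ hQ j, u i y) - damped hQ u (J n) (b n) j y :=
    fun n j y => by
      simp only [G, damped, ← Finset.sum_sub_distrib, sub_mul, one_mul]
  have hgiven : ∀ n j, IsGivenBy (piece (Φ j) (f - toZDual O (𝓕⁻ (toSchwartz (H n)))))
      (conv (kernel (Φ j)) (G n j)) := by
    intro n j
    refine isGivenBy_conv hp (hG n j) fun s => ?_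
    change f _ - toZDual O _ _ = _
    rw [hΦ.apply_fourier_mulTest hQ hu, toZDual_apply_fourier_mulTest
      (integrable_damped hQ hp hup (J n) (b n) j) (hH n j), ← integral_sub]
    · simp_rw [hGeq, sub_mul]
    · simp_rw [Finset.sum_mul]
      exact integrable_finsetSum _ fun i _ => (hu i _).1
    · exact (integrable_mul_of_memLp hp (fun q => SchwartzMap.memLp _ q volume)
        (memLp_damped hQ hup (J n) (b n) j)).congr (Eventually.of_forall fun y => mul_comm _ _)
  have hle : ∀ n j, lpNorm p (piece (Φ j) (f - toZDual O (𝓕⁻ (toSchwartz (H n))))) ≤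
      bapuConst Φ * ∑ i ∈ star₂ hQ j,
        eLpNorm (fun y => (1 - cutoff (J n) (b n) i y) * u i y) p volume := by
    intro n j
    rw [(hgiven n j).lpNorm_eq]
    refine (eLpNorm_le_of_enorm_le_conv (kernel (Φ j)).continuous (hG n j).1 hp
      (enorm_conv_le _ _)).trans (mul_le_mul' (eLpNorm_kernel_le Φ j) ?_)
    have h := eLpNorm_sum_le (μ := volume) (s := star₂ hQ j)
      (f := fun i y => (1 - cutoff (J n) (b n) i y) * u i y) (fun i _ => (hGterm n i).1) hp
    refine le_trans (le_of_eq ?_) h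
    congr 1
    funext y
    simp [G]
  have hterm : ∀ n i, eLpNorm (fun y => (1 - cutoff (J n) (b n) i y) * u i y) p volume ≤
      2 * eLpNorm (u i) p volume := by
    intro n i
    have h := eLpNorm_le_mul_eLpNorm_of_ae_le_mul (μ := volume) (c := 2) (g := u i)
      (f := fun y => (1 - cutoff (J n) (b n) i y) * u i y)
      (Eventually.of_forall fun y => by
        rw [norm_mul]
        refine mul_le_mul_of_nonneg_right ((norm_sub_le _ _).trans ?_) (norm_nonneg _)
        rw [norm_one]
        linarith [norm_cutoff_le (J n) (b n) i y]) p
    simpa using h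
  have hlp : (fun i => lpNorm p (piece (Φ i) f)) = fun i => eLpNorm (u i) p volume :=
    funext fun i => (hu i).lpNorm_eq p
  have hf' : wlNorm w q (fun i => eLpNorm (u i) p volume) < ∞ := by
    rw [← hlp]
    exact hf
  refine tendsto_wlNorm_of_dominated w hq hqt
    -- The `2` bounds `|1 - θ_i|`, and `C_Φ` comes from Young.
    (b := fun j => (bapuConst Φ * 2) * ∑ i ∈ star₂ hQ j, eLpNorm (u i) p volume)
    (fun n j => (hle n j).trans ?_) ?_ fun j => ?_
  · rw [mul_assoc]
    refine mul_le_mul_right ?_ _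
    rw [Finset.mul_sum]
    exact Finset.sum_le_sum fun i _ => hterm n i
  · rw [wlNorm_const_mul w hq]
    refine ENNReal.mul_lt_top (ENNReal.mul_lt_top hΦ.bounded (by simp)) ?_
    exact (wlNorm_sum_star₂_le hQ hw hq hfin hf').trans_lt
      (ENNReal.mul_lt_top (ENNReal.pow_lt_top hfin) hf')
  · refine tendsto_of_tendsto_of_tendsto_of_le_of_le tendsto_const_nhds ?_
      (fun n => zero_le) (fun n => hle n j)
    have h1 : Tendsto (fun n => ∑ i ∈ star₂ hQ j,
        eLpNorm (fun y => (1 - cutoff (J n) (b n) i y) * u i y) p volume) atTop (𝓝 0) := by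
      rw [← Finset.sum_const_zero (s := star₂ hQ j)]
      exact tendsto_finsetSum _ fun i _ => tendsto_eLpNorm_one_sub_mul
        (fun n => continuous_cutoff (J n) (b n) i) (fun n => norm_cutoff_le (J n) (b n) i)
        (tendsto_cutoff hJ hb i) hp hpt (hup i)
    simpa using ENNReal.Tendsto.const_mul (a := bapuConst Φ) h1 (Or.inr hΦ.bounded.ne)

end Main

end DecompositionSpace

theorem mainTheorem9 {d : ℕ} (O : Opens (EuclideanSpace ℝ (Fin d)))
    (hO : (O : Set (EuclideanSpace ℝ (Fin d))).Nonempty)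
    {ι : Type*} (Q : ι → Set (EuclideanSpace ℝ (Fin d)))
    (hQ : DecompositionSpace.IsAdmissibleCover O Q)
    (Φ : ι → 𝓓(O, ℂ)) (hΦ : DecompositionSpace.IsBAPU Q Φ)
    (w : ι → ℝ) (hw : DecompositionSpace.IsModerateWeight Q w) :
    (∀ p q : ℝ≥0∞, 1 ≤ p → 1 ≤ q → ∀ g ∈ DecompositionSpace.SO O,
      DecompositionSpace.toZDual O g ∈ DecompositionSpace.DecompSpace Φ w p q) ∧
    (∀ p q : ℝ≥0∞, 1 ≤ p → 1 ≤ q → p < ∞ → q < ∞ →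
      ∀ f ∈ DecompositionSpace.DecompSpace Φ w p q, ∀ ε : ℝ≥0∞, 0 < ε →
        ∃ g ∈ DecompositionSpace.SO O,
          DecompositionSpace.decompNorm Φ w p q (f - DecompositionSpace.toZDual O g) < ε) ∧
    (∀ p q : ℝ≥0∞, 1 ≤ p → 1 ≤ q → ∀ f ∈ DecompositionSpace.DecompSpace Φ w p q,
      ∃ F : ι → EuclideanSpace ℝ (Fin d) → ℝ,
        (∀ i x, 0 ≤ F i x) ∧
        DecompositionSpace.MemMixed w p q F ∧
        DecompositionSpace.mixedNorm w p q F ≤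
          DecompositionSpace.bapuConst Φ * DecompositionSpace.clusteringNorm Q w q ^ 2 *
            DecompositionSpace.decompNorm Φ w p q f ∧
        ∃ g : ℕ → 𝓢(EuclideanSpace ℝ (Fin d), ℂ),
          (∀ n, g n ∈ DecompositionSpace.SO O ∧
            DecompositionSpace.IsDominated F Φ (DecompositionSpace.toZDual O (g n))) ∧
          DecompositionSpace.TendstoZDual (fun n => DecompositionSpace.toZDual O (g n)) f) := by
  have hQ' := DecompositionSpace.finite_starSet hQ.card_star
  have := DecompositionSpace.countable_index hQ hΦ
  have hΓ : ∀ q : ℝ≥0∞, 1 ≤ q → DecompositionSpace.clusteringNorm Q w q < ∞ := fun q hq =>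
    DecompositionSpace.clusteringNorm_lt_top hQ.card_star hw.pos hw.moderate hq
  refine ⟨?_, ?_, ?_⟩
  · rintro p q - hq _ ⟨h, rfl⟩
    exact DecompositionSpace.decompNorm_toZDual_lt_top hΦ hQ' w p hq h
  · intro p q hp hq hpt hqt f hf ε hε
    obtain ⟨u, hu, hup⟩ :=
      DecompositionSpace.exists_isGivenBy_of_decompNorm_lt_top hw.pos hq hf
    obtain ⟨J, b, H, hJ, hb, hH⟩ := hΦ.exists_approximating_sequence hQ' hu hp hup
    obtain ⟨n, hn⟩ := ((DecompositionSpace.tendsto_decompNorm_sub hΦ hQ' hw.pos hp hq hpt hqt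
      (hΓ q hq) hf hu hup hJ hb hH).eventually_lt_const hε).exists
    exact ⟨_, ⟨H n, rfl⟩, hn⟩
  · intro p q hp hq f hf
    obtain ⟨u, hu, hup⟩ :=
      DecompositionSpace.exists_isGivenBy_of_decompNorm_lt_top hw.pos hq hf
    obtain ⟨J, b, H, hJ, hb, hH⟩ := hΦ.exists_approximating_sequence hQ' hu hp hup
    have hle := DecompositionSpace.mixedNorm_majorant_le hQ' hw.pos hp hq (hΓ q hq) hf hu hup
    refine ⟨DecompositionSpace.majorant hQ' Φ u, fun i x => ?_, ⟨fun i => ?_, ?_⟩, hle,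
      fun n => 𝓕⁻ (DecompositionSpace.toSchwartz (H n)), fun n => ⟨⟨H n, rfl⟩, ?_⟩, ?_⟩
    · exact integral_nonneg fun y =>
        mul_nonneg (norm_nonneg _) (Finset.sum_nonneg fun _ _ => norm_nonneg _)
    · exact DecompositionSpace.memLp_absConv _ hp (DecompositionSpace.memLp_sum_norm hup _)
    · exact hle.trans_lt (ENNReal.mul_lt_top
        (ENNReal.mul_lt_top hΦ.bounded (ENNReal.pow_lt_top (hΓ q hq))) hf)
    · exact DecompositionSpace.isDominated_toZDual hQ' hp hup (hH n)
    · exact DecompositionSpace.tendstoZDual_of_approximating hΦ hQ' hu hp hup hJ hb hH
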